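/- A sensor samples packets $k=1,2,\dots$ at times $S_k$, with $S_1=0$; packet $k$ is received at $R_k=S_k+D_k$, and $S_{k+1}=R_k+W_k$ with waiting time $W_k\ge 0$. The delays $D_k$ are i.i.d. with a law that is absolutely continuous on $[0,\infty)$ and satisfies $0<\overline D_{\mathsf{lb}}\le\overline D:=\mathbb E[D]\le\overline D_{\mathsf{ub}}<\infty$ and $0<M_{\mathsf{lb}}\le\mathbb E[D^2]\le M_{\mathsf{ub}}<\infty$. The age of information (AoI) at time $t$ is $A(t)=t-S_{i(t)}$, where $i(t)$ is the largest $k$ with $R_k\le t$; before the first reception $A(t)=t+a_0$, where $a_0\ge 0$ is a fixed initial age. A policy $\pi=(W_k)$ is causal if each $W_k$ is a function of $D_1,\dots,D_k$ and of the sensor's private randomness, which is independent of all delays; here this is the random variable $\gamma_1$ introduced below. Let $\Pi$ be the class of causal policies with $W_k\in[0,W_{\mathsf{ub}}]$ almost surely for all $k$, and let $$\overline A_\pi=\limsup_{K\to\infty}\frac{\mathbb E\left[\int_0^{S_{K+1}}A(t)\,dt\right]}{\mathbb E[S_{K+1}]},\qquad \overline A_{\pi^\star}=\inf_{\pi\in\Pi}\overline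 A_\pi,\qquad \gamma^\star=\overline A_{\pi^\star}-\overline D .$$ (There is no constraint on the sampling frequency: $f_{\mathsf{max}}=\infty$.) Let $\gamma_{\mathsf{lb}}=\tfrac12\overline D_{\mathsf{lb}}$ and $\gamma_{\mathsf{ub}}=\tfrac12 M_{\mathsf{ub}}/\overline D_{\mathsf{lb}}$, and assume that $W_{\mathsf{ub}}\ge\gamma_{\mathsf{ub}}$. The online sampler draws $\gamma_1$ uniformly from $[\gamma_{\mathsf{lb}},\gamma_{\mathsf{ub}}]$, independently of the delays. In cycle $k$ it waits $W_k=\max\{\gamma_k-D_k,0\}$, sets $L_k=D_k+W_k$ and $Q_k=\tfrac12L_k^2$, and updates $$\gamma_{k+1}=\min\{\gamma_{\mathsf{ub}},\max\{\gamma_k+\eta_k(Q_k-\gamma_kL_k),\gamma_{\mathsf{lb}}\}\},\qquad \eta_1=\frac1{2\overline D_{\mathsf{lb}}},\quad \eta_k=\frac1{(k+2)\overline D_{\mathsf{lb}}}\ (k\ge2).$$ **Theorem.** Suppose that the delay is bounded: $D<B<\infty$ almost surely. Then $\gamma^\star$ is the optimal threshold, that is, the policy $W_k=\max\{\gamma^\star-D_k,0\}$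 belongs to $\Pi$ and attains the minimum $\overline A_{\pi^\star}$. Under the online sampler, almost surely, $$\lim_{K\to\infty}\gamma_K=\gamma^\star\qquad\text{and}\qquad \lim_{K\to\infty}\frac{\int_0^{S_{K+1}}A(t)\,dt}{S_{K+1}}=\overline A_{\pi^\star}.$$ -/

import Mathlib

open MeasureTheory ProbabilityTheory Filter Topology
open scoped ENNReal

noncomputable section

namespace AoI

/-! Sample paths. Packets (and cycles) are numbered `0, 1, 2, …`, so the first packet is packet `0`.
`d k` is the transmission delay of packet `k` and `w k` is the waiting time between its reception
and the sampling of packet `k + 1`. -/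

/-- Sampling time of packet `k`: the first packet is sampled at time `0`, and packet `k + 1` is
sampled after waiting `w k` from the reception of packet `k`. Thus `samplingTime d w K` is the end
of the first `K` cycles. -/
def samplingTime (d w : ℕ → ℝ) : ℕ → ℝ
  | 0 => 0
  | k + 1 => samplingTime d w k + d k + w k

/-- Reception time of packet `k`. -/
def receptionTime (d w : ℕ → ℝ) (k : ℕ) : ℝ := samplingTime d w k + d k

open scoped Classical in
/-- Sampling time of the latest packet received by time `t`. Before the first reception, the
receiver holds an older packet, sampled at time `-a₀`. -/
def freshestSample (a₀ : ℝ) (d w : ℕ → ℝ) (t : ℝ) : ℝ :=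
  if ∃ k, receptionTime d w k ≤ t then samplingTime d w (sSup {k : ℕ | receptionTime d w k ≤ t})
  else -a₀

/-- The age of information at time `t`; `a₀` is the age at time `0`. -/
def age (a₀ : ℝ) (d w : ℕ → ℝ) (t : ℝ) : ℝ := t - freshestSample a₀ d w t

/-- The integral of the age over the first `K` cycles. -/
def cumulativeAge (a₀ : ℝ) (d w : ℕ → ℝ) (K : ℕ) : ℝ :=
  ∫ t in (0 : ℝ)..samplingTime d w K, age a₀ d w t

/-- The delay distribution is absolutely continuous on `[0, ∞)`, with known bounds on its first
two moments (which are finite). -/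
structure DelayAssumption (μ : Measure ℝ) (Dlb Dub Mlb Mub : ℝ) : Prop where
  absolutelyContinuous : μ ≪ volume.restrict (Set.Ici (0 : ℝ))
  integrable : Integrable (fun x : ℝ => x) μ
  integrable_sq : Integrable (fun x : ℝ => x ^ 2) μ
  lb_pos : 0 < Dlb
  lb_le_mean : Dlb ≤ ∫ x, x ∂μ
  mean_le_ub : ∫ x, x ∂μ ≤ Dub
  sq_lb_pos : 0 < Mlb
  sq_lb_le : Mlb ≤ ∫ x, x ^ 2 ∂μ
  sq_le_ub : ∫ x, x ^ 2 ∂μ ≤ Mub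

section Policies

variable {Ω : Type*} [MeasurableSpace Ω]

/-- The information available when the waiting time after packet `k` is chosen: the
transmitter's private random seed and the delays of packets `0, …, k`. (The past sampling times are
functions of these.) -/
abbrev history (seed : Ω → ℝ) (D : ℕ → Ω → ℝ) (k : ℕ) : MeasurableSpace Ω :=
  MeasurableSpace.comap seed inferInstance ⊔
    ⨆ i ∈ Set.Iic k, MeasurableSpace.comap (D i) inferInstance

/-- Causal sampling policies with waiting times in `[0, Wub]`. -/
structure IsPolicy (P : Measure Ω) (seed : Ω → ℝ) (D : ℕ → Ω → ℝ) (Wub : ℝ)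
    (W : ℕ → Ω → ℝ) : Prop where
  causal : ∀ k, Measurable[history seed D k] (W k)
  bounded : ∀ k, ∀ᵐ ω ∂P, W k ω ∈ Set.Icc 0 Wub

/-- Expected time-average age of information of the policy `W`. -/
def averageAge (P : Measure Ω) (a₀ : ℝ) (D W : ℕ → Ω → ℝ) : ℝ :=
  limsup (fun K : ℕ =>
    (∫ ω, cumulativeAge a₀ (fun k => D k ω) (fun k => W k ω) K ∂P) /
      ∫ ω, samplingTime (fun k => D k ω) (fun k => W k ω) K ∂P) atTop

/-- The sampling frequency constraint: the long-run expected cycle length is at least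
`1 / fmax`. It is void if `fmax = ∞`. -/
def FrequencyConstraint (P : Measure Ω) (fmax : ℝ≥0∞) (D W : ℕ → Ω → ℝ) : Prop :=
  (fmax⁻¹).toReal ≤ liminf (fun K : ℕ =>
    (∫ ω, samplingTime (fun k => D k ω) (fun k => W k ω) K ∂P) / (K : ℝ)) atTop

/-- Feasible policies: causal, bounded, and obeying the sampling frequency constraint. -/
def IsFeasible (P : Measure Ω) (seed : Ω → ℝ) (D : ℕ → Ω → ℝ) (Wub : ℝ) (fmax : ℝ≥0∞)
    (W : ℕ → Ω → ℝ) : Prop :=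
  IsPolicy P seed D Wub W ∧ FrequencyConstraint P fmax D W

/-- The minimum average age of information over all feasible policies. -/
def minAverageAge (P : Measure Ω) (a₀ : ℝ) (seed : Ω → ℝ) (D : ℕ → Ω → ℝ) (Wub : ℝ)
    (fmax : ℝ≥0∞) : ℝ :=
  sInf {a : ℝ | ∃ W, IsFeasible P seed D Wub fmax W ∧ averageAge P a₀ D W = a}

/-- `γ⋆`: the minimum average age minus the mean delay (`μ` is the delay distribution). -/
def optimalThreshold (P : Measure Ω) (a₀ : ℝ) (seed : Ω → ℝ) (D : ℕ → Ω → ℝ) (μ : Measure ℝ)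
    (Wub : ℝ) (fmax : ℝ≥0∞) : ℝ :=
  minAverageAge P a₀ seed D Wub fmax - ∫ x, x ∂μ

/-- The stationary policy that waits until the age of the last received packet is at least `γ`. -/
def thresholdPolicy (D : ℕ → Ω → ℝ) (γ : ℝ) (k : ℕ) (ω : Ω) : ℝ := max (γ - D k ω) 0

end Policies

/-! The online sampler. -/

/-- Lower bound of the projection interval. -/
def gammaLb (Dlb : ℝ) : ℝ := Dlb / 2

/-- Upper bound of the projection interval. -/
def gammaUb (Dlb Dub Mub : ℝ) (fmax : ℝ≥0∞) : ℝ :=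
  (Mub / 2 + Dub * (fmax⁻¹).toReal + (fmax⁻¹).toReal ^ 2 / 2) / (Dlb + (fmax⁻¹).toReal)

/-- The step size used in the `n`-th cycle, the cycles being counted here from `n = 1`. -/
def stepSize (Dlb : ℝ) (n : ℕ) : ℝ :=
  if n = 1 then 1 / (2 * Dlb) else 1 / (((n : ℝ) + 2) * Dlb)

/-- The waiting time of the online sampler at threshold estimate `γ`, accumulated violation `u`
and observed delay `x`. -/
def onlineWait (V γ u x : ℝ) : ℝ := max (γ + u / V - x) 0

/-- One cycle of the online sampler, with observed delay `x` and step size `η`: from the threshold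
estimate and the accumulated violation `s = (γ, u)` to those of the next cycle. -/
def onlineStep (Dlb Dub Mub : ℝ) (fmax : ℝ≥0∞) (V η x : ℝ) (s : ℝ × ℝ) : ℝ × ℝ :=
  let L := x + onlineWait V s.1 s.2 x
  let Q := L ^ 2 / 2
  (min (gammaUb Dlb Dub Mub fmax) (max (s.1 + η * (Q - s.1 * L)) (gammaLb Dlb)),
    max (s.2 + ((fmax⁻¹).toReal - L)) 0)

/-- Threshold estimate and accumulated violation of the online sampler in cycle `k` (cycles are
numbered from `0`), started from the estimate `γ₁` with violation `0`, on the delays `d`. -/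
def onlineState (Dlb Dub Mub : ℝ) (fmax : ℝ≥0∞) (V γ₁ : ℝ) (d : ℕ → ℝ) : ℕ → ℝ × ℝ
  | 0 => (γ₁, 0)
  | k + 1 => onlineStep Dlb Dub Mub fmax V (stepSize Dlb (k + 1)) (d k)
      (onlineState Dlb Dub Mub fmax V γ₁ d k)

/-- The threshold estimate of the online sampler in cycle `k`. -/
def onlineThreshold (Dlb Dub Mub : ℝ) (fmax : ℝ≥0∞) (V γ₁ : ℝ) (d : ℕ → ℝ) (k : ℕ) : ℝ :=
  (onlineState Dlb Dub Mub fmax V γ₁ d k).1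

/-- The waiting time of the online sampler in cycle `k`. -/
def onlineWaiting (Dlb Dub Mub : ℝ) (fmax : ℝ≥0∞) (V γ₁ : ℝ) (d : ℕ → ℝ) (k : ℕ) : ℝ :=
  onlineWait V (onlineState Dlb Dub Mub fmax V γ₁ d k).1
    (onlineState Dlb Dub Mub fmax V γ₁ d k).2 (d k)

end AoI

end

/-! Let L_k be the length of cycle k. Integrating the age over that cycle gives L_k²/2 + L_{k-1}
D_k, with a₀ in place of L_{-1}. Causality makes L_{k-1} independent of D_k, so up to a vanishing
boundary term the average age of any policy is ∑E[L_k²/2] / ∑E[L_k] plus the mean delay.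

Minimizing this ratio is a fractional program. For a multiplier γ, the cost l²/2 - γl over l ≥ D is
least at l = max(D, γ); call this minimum `cycleCost γ D`. If g is a root of E[`cycleCost g D`] = 0,
every cycle of every policy satisfies E[L²/2] ≥ g E[L], with equality for threshold g. Hence g plus
the mean delay is the minimum, and γ⋆ = g (`isLeast_averageAge`). A root exists in the projection
interval by the intermediate value theorem.

The online sampler is a projected Robbins–Monro iteration for this equation. `cycleCost` is a
minimum of functions affine in γ with slopes at most -D, hence strongly decreasing
(`sub_mul_cycleCost_sub_le`). As the current estimate is independent of the current delay, the mean
square error contracts, and the step sizes make it O(1/k). These errors are summable along k = n²,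
which gives almost sure convergence there; increments of size O(1/k) fill the gaps
(`tendsto_of_tendsto_sq`).

For the realized age, convergent thresholds may be replaced by g inside running averages, and the
strong law finishes. The products L_{k-1} D_k are not independent, but those of one parity are. -/

namespace AoI

/-! ### Sample paths -/

/-- The length of the previous cycle; the initial age plays this role in the first cycle. -/
def prevLength (a₀ : ℝ) (l : ℕ → ℝ) : ℕ → ℝ
  | 0 => a₀
  | k + 1 => l k

theorem samplingTime_eq_sum (d w : ℕ → ℝ) (K : ℕ) :
    samplingTime d w K = ∑ k ∈ Finset.range K, (d k + w k) := by
  induction K with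
  | zero => rfl
  | succ K ih => rw [Finset.sum_range_succ, ← ih, samplingTime]; ring

theorem sum_prevLength_succ (a₀ : ℝ) (l : ℕ → ℝ) (K : ℕ) :
    ∑ k ∈ Finset.range (K + 1), prevLength a₀ l k = a₀ + ∑ k ∈ Finset.range K, l k := by
  rw [Finset.sum_range_succ', add_comm]; rfl

section Path

variable {d w : ℕ → ℝ} (hd : ∀ k, 0 ≤ d k) (hw : ∀ k, 0 ≤ w k)
include hd hw

theorem receptionTime_monotone : Monotone (receptionTime d w) := by
  refine monotone_nat_of_le_succ fun k => ?_
  simp only [receptionTime, samplingTime]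
  linarith [hd (k + 1), hw k]

theorem freshestSample_of_lt (a₀ : ℝ) {t : ℝ} (ht : t < receptionTime d w 0) :
    freshestSample a₀ d w t = -a₀ := by
  rw [freshestSample, if_neg]
  rintro ⟨k, hk⟩
  linarith [receptionTime_monotone hd hw (Nat.zero_le k)]

theorem freshestSample_of_mem (a₀ : ℝ) {t : ℝ} {k : ℕ} (h₁ : receptionTime d w k ≤ t)
    (h₂ : t < receptionTime d w (k + 1)) : freshestSample a₀ d w t = samplingTime d w k := by
  -- Monotone reception times make this an initial segment, so its `sSup` in `ℕ` is a genuine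
  -- maximum.
  have hset : {j : ℕ | receptionTime d w j ≤ t} = Set.Iic k := by
    ext j
    simp only [Set.mem_ofPred_eq, Set.mem_Iic]
    constructor
    · intro hj
      by_contra hlt
      linarith [receptionTime_monotone hd hw (Nat.succ_le_of_lt (not_le.mp hlt))]
    · intro hj
      exact (receptionTime_monotone hd hw hj).trans h₁
  rw [freshestSample, if_pos ⟨k, h₁⟩, hset, csSup_Iic]

/-- Until packet k arrives, the freshest packet is the preceding one, sampled one cycle length
earlier. -/
theorem age_before_reception (a₀ : ℝ) (k : ℕ) {t : ℝ}
    (ht : t ∈ Set.Ioo (samplingTime d w k) (receptionTime d w k)) :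
    age a₀ d w t = t - samplingTime d w k + prevLength a₀ (fun k => d k + w k) k := by
  cases k with
  | zero =>
    rw [age, freshestSample_of_lt hd hw a₀ ht.2]
    simp [samplingTime, prevLength]
  | succ k =>
    rw [age, freshestSample_of_mem hd hw a₀ (k := k) ?_ ht.2]
    · simp only [samplingTime, prevLength]; ring
    · have := ht.1
      simp only [receptionTime, samplingTime] at this ⊢
      linarith [hw k]

theorem age_after_reception (a₀ : ℝ) (k : ℕ) {t : ℝ}
    (ht : t ∈ Set.Ioo (receptionTime d w k) (samplingTime d w (k + 1))) :
    age a₀ d w t = t - samplingTime d w k := by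
  rw [age, freshestSample_of_mem hd hw a₀ ht.1.le]
  have := hd (k + 1)
  simp only [receptionTime]
  linarith [ht.2]

/-- The ramp from the sampling time contributes half the squared cycle length; the excess before
reception is a rectangle of width `d k`. -/
theorem integral_age_cycle (a₀ : ℝ) (k : ℕ) :
    IntervalIntegrable (age a₀ d w) volume (samplingTime d w k) (samplingTime d w (k + 1)) ∧
      ∫ t in samplingTime d w k..samplingTime d w (k + 1), age a₀ d w t =
        (d k + w k) ^ 2 / 2 + prevLength a₀ (fun k => d k + w k) k * d k := by
  have h₁ : samplingTime d w k ≤ receptionTime d w k := le_add_of_nonneg_right (hd k)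
  have h₂ : receptionTime d w k ≤ samplingTime d w (k + 1) := le_add_of_nonneg_right (hw k)
  have e₁ : Set.EqOn (fun t => t - samplingTime d w k + prevLength a₀ (fun k => d k + w k) k)
      (age a₀ d w) (Set.uIoo (samplingTime d w k) (receptionTime d w k)) := by
    rw [Set.uIoo_of_le h₁]
    exact fun t ht => (age_before_reception hd hw a₀ k ht).symm
  have e₂ : Set.EqOn (fun t => t - samplingTime d w k)
      (age a₀ d w) (Set.uIoo (receptionTime d w k) (samplingTime d w (k + 1))) := by
    rw [Set.uIoo_of_le h₂]
    exact fun t ht => (age_after_reception hd hw a₀ k ht).symm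
  have i₁ := IntervalIntegrable.congr_uIoo (μ := volume)
    (Continuous.intervalIntegrable (by fun_prop) _ _) e₁
  have i₂ := IntervalIntegrable.congr_uIoo (μ := volume)
    (Continuous.intervalIntegrable (by fun_prop) _ _) e₂
  refine ⟨i₁.trans i₂, ?_⟩
  rw [← intervalIntegral.integral_add_adjacent_intervals i₁ i₂,
    ← intervalIntegral.integral_congr_uIoo e₁, ← intervalIntegral.integral_congr_uIoo e₂]
  rw [intervalIntegral.integral_add, intervalIntegral.integral_sub, intervalIntegral.integral_sub]
  · simp only [integral_id, intervalIntegral.integral_const, smul_eq_mul, receptionTime,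
      samplingTime]
    ring
  all_goals exact Continuous.intervalIntegrable (by fun_prop) _ _

theorem cumulativeAge_eq_sum (a₀ : ℝ) (K : ℕ) :
    cumulativeAge a₀ d w K = ∑ k ∈ Finset.range K,
      ((d k + w k) ^ 2 / 2 + prevLength a₀ (fun k => d k + w k) k * d k) := by
  have h := intervalIntegral.sum_integral_adjacent_intervals (μ := volume) (f := age a₀ d w)
    (a := samplingTime d w) (n := K) fun k _ => (integral_age_cycle hd hw a₀ k).1
  rw [cumulativeAge, show (0 : ℝ) = samplingTime d w 0 from rfl, ← h]
  exact Finset.sum_congr rfl fun k _ => (integral_age_cycle hd hw a₀ k).2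

end Path

/-! ### Independence of the next delay from the history -/

/-- The intersections s ∩ t form a π-system generating `m₁ ⊔ m₂`, and on it P(s ∩ t ∩ u) = P(s) P(t
∩ u) = P(s) P(t) P(u). -/
theorem indep_sup_left {Ω : Type*} {mΩ : MeasurableSpace Ω} {P : Measure Ω} [IsProbabilityMeasure P]
    {m₁ m₂ m₃ : MeasurableSpace Ω} (h₁ : m₁ ≤ mΩ) (h₂ : m₂ ≤ mΩ) (h₃ : m₃ ≤ mΩ)
    (h : Indep m₁ (m₂ ⊔ m₃) P) (h' : Indep m₂ m₃ P) : Indep (m₁ ⊔ m₂) m₃ P := by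
  refine IndepSets.indep (p1 := {u | ∃ s t, MeasurableSet[m₁] s ∧ MeasurableSet[m₂] t ∧ s ∩ t = u})
    (p2 := {s | MeasurableSet[m₃] s}) (sup_le h₁ h₂) h₃ ?_
    (@MeasurableSpace.isPiSystem_measurableSet _ m₃) ?_
    (@MeasurableSpace.generateFrom_measurableSet _ m₃).symm ?_
  · rintro _ ⟨s, t, hs, ht, rfl⟩ _ ⟨s', t', hs', ht', rfl⟩ -
    exact ⟨s ∩ s', t ∩ t', hs.inter hs', ht.inter ht', Set.inter_inter_inter_comm _ _ _ _⟩
  · refine le_antisymm (sup_le ?_ ?_) (MeasurableSpace.generateFrom_le ?_)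
    · exact fun s hs => MeasurableSpace.measurableSet_generateFrom
        ⟨s, Set.univ, hs, MeasurableSet.univ, Set.inter_univ s⟩
    · exact fun s hs => MeasurableSpace.measurableSet_generateFrom
        ⟨Set.univ, s, MeasurableSet.univ, hs, Set.univ_inter s⟩
    · rintro _ ⟨s, t, hs, ht, rfl⟩
      exact ((le_sup_left : m₁ ≤ m₁ ⊔ m₂) s hs).inter ((le_sup_right : m₂ ≤ m₁ ⊔ m₂) t ht)
  · rw [IndepSets_iff]
    rintro _ u ⟨s, t, hs, ht, rfl⟩ hu
    rw [Indep_iff] at h h'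
    have hsup {v : Set Ω} (hv : MeasurableSet[m₂] v) : MeasurableSet[m₂ ⊔ m₃] v :=
      (le_sup_left : m₂ ≤ m₂ ⊔ m₃) v hv
    have hu' : MeasurableSet[m₂ ⊔ m₃] u := (le_sup_right : m₃ ≤ m₂ ⊔ m₃) u hu
    rw [Set.inter_assoc, h s (t ∩ u) hs ((hsup ht).inter hu'), h' t u ht hu, h s t hs (hsup ht),
      mul_assoc]

section History

variable {Ω : Type*} {seed : Ω → ℝ} {D : ℕ → Ω → ℝ}

theorem history_mono (seed : Ω → ℝ) (D : ℕ → Ω → ℝ) : Monotone (history seed D) := fun _ _ h =>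
  sup_le_sup_left (biSup_mono fun _ hi => le_trans hi h) _

theorem measurable_seed_history (k : ℕ) : Measurable[history seed D k] seed :=
  Measurable.mono (comap_measurable seed) le_sup_left le_rfl

theorem measurable_delay_history {i k : ℕ} (h : i ≤ k) : Measurable[history seed D k] (D i) :=
  Measurable.mono (comap_measurable (D i))
    (le_sup_of_le_right (le_iSup₂_of_le i h le_rfl)) le_rfl

variable [MeasurableSpace Ω]

theorem history_le (hseed : Measurable seed) (hD : ∀ k, Measurable (D k)) (k : ℕ) :
    history seed D k ≤ ‹MeasurableSpace Ω› :=
  sup_le hseed.comap_le (iSup₂_le fun i _ => (hD i).comap_le)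

theorem indep_history {P : Measure Ω} [IsProbabilityMeasure P] (hseed : Measurable seed)
    (hD : ∀ k, Measurable (D k)) (hD_indep : iIndepFun D P)
    (hseed_indep : IndepFun seed (fun ω k => D k ω) P) (k : ℕ) :
    Indep (history seed D k) (MeasurableSpace.comap (D (k + 1)) inferInstance) P := by
  have hpi (i : ℕ) : MeasurableSpace.comap (D i) inferInstance ≤
      MeasurableSpace.comap (fun ω k => D k ω) MeasurableSpace.pi := by
    have : Measurable[MeasurableSpace.comap (fun ω k => D k ω) MeasurableSpace.pi] (D i) :=
      (measurable_pi_apply i).comp (comap_measurable fun ω k => D k ω)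
    exact this.comap_le
  refine indep_sup_left hseed.comap_le (iSup₂_le fun i _ => (hD i).comap_le) (hD _).comap_le
    (indep_of_indep_of_le_right hseed_indep (sup_le (iSup₂_le fun i _ => hpi i) (hpi _))) ?_
  have h := indep_iSup_of_disjoint (fun i => (hD i).comap_le) hD_indep
    (S := Set.Iic k) (T := {k + 1}) (by simp)
  simpa using h

theorem indepFun_of_measurable_history {P : Measure Ω} [IsProbabilityMeasure P]
    (hseed : Measurable seed)
    (hD : ∀ k, Measurable (D k)) (hD_indep : iIndepFun D P)
    (hseed_indep : IndepFun seed (fun ω k => D k ω) P) {k : ℕ} {X : Ω → ℝ}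
    (hX : Measurable[history seed D k] X) : IndepFun X (D (k + 1)) P :=
  indep_of_indep_of_le_left (indep_history hseed hD hD_indep hseed_indep k) hX.comap_le

end History

/-! ### The cost of a cycle at a given threshold -/

/-- The minimum of `l ^ 2 / 2 - γ * l` over the cycle lengths `l ≥ x`. -/
noncomputable def cycleCost (γ x : ℝ) : ℝ := max x γ ^ 2 / 2 - γ * max x γ

theorem cycleCost_le {γ x l : ℝ} (h : x ≤ l) : cycleCost γ x ≤ l ^ 2 / 2 - γ * l := by
  rw [cycleCost]
  rcases le_total x γ with hx | hx
  · rw [max_eq_right hx]; nlinarith [sq_nonneg (l - γ)]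
  · rw [max_eq_left hx]; nlinarith [mul_nonneg (sub_nonneg.2 h) (sub_nonneg.2 hx)]

/-- The minimizer for γ is a competitor in the minimum for γ'. This is the supergradient inequality
of a concave function. -/
theorem cycleCost_sub_ge (γ γ' x : ℝ) :
    (γ' - γ) * max x γ ≤ cycleCost γ x - cycleCost γ' x := by
  have := cycleCost_le (γ := γ') (le_max_left x γ)
  rw [cycleCost]
  linarith

/-- The slopes in γ are minus cycle lengths, hence at most `-x`. This strong monotonicity drives the
contraction of the online estimates. -/
theorem sub_mul_cycleCost_sub_le (γ γ' x : ℝ) :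
    (γ - γ') * (cycleCost γ x - cycleCost γ' x) ≤ -(x * (γ - γ') ^ 2) := by
  rcases le_total γ γ' with h | h
  · have h₁ := cycleCost_sub_ge γ γ' x
    nlinarith [le_max_left x γ, mul_le_mul_of_nonneg_left (le_max_left x γ) (sub_nonneg.2 h)]
  · have h₁ := cycleCost_sub_ge γ' γ x
    nlinarith [le_max_left x γ', mul_le_mul_of_nonneg_left (le_max_left x γ') (sub_nonneg.2 h)]

/-- Completing the square at 2γ. The constant makes the mean cost nonnegative at γ = `Dlb / 2`, the
lower end of the projection interval. -/
theorem le_cycleCost {γ : ℝ} (hγ : 0 ≤ γ) (x : ℝ) : γ * x - 2 * γ ^ 2 ≤ cycleCost γ x := by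
  rw [cycleCost]
  nlinarith [sq_nonneg (max x γ - 2 * γ), mul_le_mul_of_nonneg_left (le_max_left x γ) hγ]

theorem abs_cycleCost_le {γ x C : ℝ} (hγ : 0 ≤ γ) (hγC : γ ≤ C) (hxC : x ≤ C) :
    |cycleCost γ x| ≤ C ^ 2 := by
  have h₁ : max x γ ≤ C := max_le hxC hγC
  have h₂ : γ ≤ max x γ := le_max_right x γ
  rw [cycleCost, abs_le]
  constructor <;> nlinarith [mul_nonneg hγ (hγ.trans h₂)]

theorem continuous_cycleCost_left (x : ℝ) : Continuous fun γ => cycleCost γ x := by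
  unfold cycleCost; fun_prop

theorem continuous_cycleCost_right (γ : ℝ) : Continuous (cycleCost γ) := by
  unfold cycleCost; fun_prop

/-! ### The threshold equation under the delay law -/

section Law

variable {μ : Measure ℝ} {Dlb Dub Mlb Mub : ℝ}

theorem gammaUb_top (Dlb Dub Mub : ℝ) : gammaUb Dlb Dub Mub ⊤ = Mub / 2 / Dlb := by
  simp [gammaUb]

theorem gammaLb_pos (hμ : DelayAssumption μ Dlb Dub Mlb Mub) : 0 < gammaLb Dlb :=
  half_pos hμ.lb_pos

theorem DelayAssumption.mean_pos (hμ : DelayAssumption μ Dlb Dub Mlb Mub) : 0 < ∫ x, x ∂μ :=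
  hμ.lb_pos.trans_le hμ.lb_le_mean

variable [IsProbabilityMeasure μ]

theorem integrable_cycleCost (hμ : DelayAssumption μ Dlb Dub Mlb Mub) (γ : ℝ) :
    Integrable (cycleCost γ) μ := by
  have h : MemLp (fun x : ℝ => x) 2 μ :=
    (memLp_two_iff_integrable_sq (by fun_prop)).2 hμ.integrable_sq
  have h' : MemLp (fun x : ℝ => max x γ) 2 μ := h.sup (memLp_const γ)
  exact (h'.integrable_sq.div_const 2).sub ((h'.integrable (by norm_num)).const_mul γ)

theorem gammaLb_le_gammaUb (hμ : DelayAssumption μ Dlb Dub Mlb Mub) :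
    gammaLb Dlb ≤ gammaUb Dlb Dub Mub ⊤ := by
  have hpos := hμ.lb_pos
  -- Integrating (x - `Dlb`)² ≥ 0 gives `Dlb`² ≤ E[D²] ≤ `Mub`, since the mean is at least `Dlb`.
  have h : 2 * Dlb * ∫ x, x ∂μ ≤ (∫ x, x ^ 2 ∂μ) + Dlb ^ 2 := by
    have := integral_mono (hμ.integrable.const_mul (2 * Dlb))
      (hμ.integrable_sq.add (integrable_const (Dlb ^ 2)))
      (fun x => by
        simp only [Pi.add_apply]
        nlinarith [sq_nonneg (x - Dlb)])
    rw [integral_const_mul, integral_add' hμ.integrable_sq (integrable_const _)] at this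
    simpa using this
  rw [gammaUb_top, gammaLb, le_div_iff₀ hpos]
  nlinarith [hμ.lb_le_mean, hμ.sq_le_ub]

/-- The equation that determines the optimal threshold has a root in the projection interval. -/
theorem exists_integral_cycleCost_eq_zero (hμ : DelayAssumption μ Dlb Dub Mlb Mub) :
    ∃ γ ∈ Set.Icc (gammaLb Dlb) (gammaUb Dlb Dub Mub ⊤), ∫ x, cycleCost γ x ∂μ = 0 := by
  have hlb := gammaLb_pos hμ
  have hpos := hμ.lb_pos
  set C := gammaUb Dlb Dub Mub ⊤ with hC
  have hcont : ContinuousOn (fun γ => ∫ x, cycleCost γ x ∂μ) (Set.Icc (gammaLb Dlb) C) := by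
    refine continuousOn_of_dominated (bound := fun x => 2 * x ^ 2 + 2 * C ^ 2)
      (fun γ _ => (continuous_cycleCost_right γ).aestronglyMeasurable) (fun γ hγ => ?_)
      ((hμ.integrable_sq.const_mul 2).add (integrable_const _))
      (Eventually.of_forall fun x => (continuous_cycleCost_left x).continuousOn)
    refine Eventually.of_forall fun x => ?_
    have h0 : 0 ≤ γ := hlb.le.trans hγ.1
    have := abs_cycleCost_le (x := x) (C := |x| + C) h0
      (by linarith [hγ.2, abs_nonneg x]) (by linarith [le_abs_self x, hγ.2])
    rw [Real.norm_eq_abs]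
    nlinarith [sq_nonneg (|x| - C), sq_abs x]
  have h₁ : 0 ≤ ∫ x, cycleCost (gammaLb Dlb) x ∂μ := by
    have := integral_mono ((hμ.integrable.const_mul (gammaLb Dlb)).sub
      (integrable_const (2 * gammaLb Dlb ^ 2))) (integrable_cycleCost hμ (gammaLb Dlb))
      (le_cycleCost hlb.le)
    rw [integral_sub' (hμ.integrable.const_mul _) (integrable_const _), integral_const_mul] at this
    refine le_trans ?_ this
    simp only [integral_const, probReal_univ, one_smul, gammaLb]
    nlinarith [hμ.lb_le_mean]
  -- The competitor without waiting costs E[D²]/2 - C E[D] ≤ `Mub`/2 - C `Dlb`, which is 0 by the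
  -- choice of C.
  have h₂ : ∫ x, cycleCost C x ∂μ ≤ 0 := by
    have := integral_mono (integrable_cycleCost hμ C)
      ((hμ.integrable_sq.div_const 2).sub (hμ.integrable.const_mul C))
      (fun x => cycleCost_le (le_refl x))
    rw [integral_sub' (hμ.integrable_sq.div_const 2) (hμ.integrable.const_mul C),
      integral_div, integral_const_mul] at this
    refine this.trans ?_
    have hCD : C * Dlb = Mub / 2 := by rw [hC, gammaUb_top]; field_simp
    have hC0 : 0 ≤ C := hlb.le.trans (gammaLb_le_gammaUb hμ)
    nlinarith [hμ.sq_le_ub, mul_le_mul_of_nonneg_left hμ.lb_le_mean hC0]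
  exact (intermediate_value_Icc' (gammaLb_le_gammaUb hμ) hcont) ⟨h₂, h₁⟩

end Law

/-! ### Ratios of partial sums -/

/-- The two sums differ only by a bounded boundary term, while the denominator grows linearly. -/
theorem tendsto_sum_prevLength_sub_div {a₀ δ C : ℝ} {m : ℕ → ℝ} (hδ : 0 < δ)
    (hm : ∀ k, δ ≤ m k) (hmC : ∀ k, m k ≤ C) :
    Tendsto (fun K : ℕ => (∑ k ∈ Finset.range K, prevLength a₀ m k -
      ∑ k ∈ Finset.range K, m k) / ∑ k ∈ Finset.range K, m k) atTop (𝓝 0) := by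
  rw [← tendsto_add_atTop_iff_nat 1]
  have hlim : Tendsto (fun K : ℕ => ((|a₀| + C) / δ) * (1 / ((K : ℝ) + 1))) atTop (𝓝 0) := by
    simpa using tendsto_one_div_add_atTop_nhds_zero_nat.const_mul ((|a₀| + C) / δ)
  refine squeeze_zero_norm (fun K => ?_) hlim
  have hsum : ((K : ℝ) + 1) * δ ≤ ∑ k ∈ Finset.range (K + 1), m k := by
    have := Finset.card_nsmul_le_sum (Finset.range (K + 1)) m δ (fun k _ => hm k)
    simpa using this
  have hpos : 0 < ((K : ℝ) + 1) * δ := by positivity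
  have habs : |a₀ - m K| ≤ |a₀| + C := by
    refine (abs_sub _ _).trans ?_
    rw [abs_of_pos (hδ.trans_le (hm K))]
    linarith [hmC K]
  rw [sum_prevLength_succ, Real.norm_eq_abs, abs_div, abs_of_pos (hpos.trans_le hsum),
    show a₀ + ∑ k ∈ Finset.range K, m k - ∑ k ∈ Finset.range (K + 1), m k = a₀ - m K by
      rw [Finset.sum_range_succ]; ring]
  calc |a₀ - m K| / ∑ k ∈ Finset.range (K + 1), m k ≤ (|a₀| + C) / (((K : ℝ) + 1) * δ) := by
        gcongr
        exact (abs_nonneg _).trans habs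
    _ = _ := by field_simp

/-! ### Expected age of causal policies -/

/-- The delays are i.i.d. with law `μ` and independent of the seed. -/
structure IsDelayModel {Ω : Type*} [MeasurableSpace Ω] (P : Measure Ω) (seed : Ω → ℝ)
    (D : ℕ → Ω → ℝ) (μ : Measure ℝ) : Prop where
  measurable_seed : Measurable seed
  measurable : ∀ k, Measurable (D k)
  map_eq : ∀ k, P.map (D k) = μ
  iIndepFun : iIndepFun D P
  indepFun_seed : IndepFun seed (fun ω k => D k ω) P

section Model

variable {Ω : Type*} [MeasurableSpace Ω] {P : Measure Ω} [IsProbabilityMeasure P]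
  {seed : Ω → ℝ} {D : ℕ → Ω → ℝ} {μ : Measure ℝ} {Dlb Dub Mlb Mub : ℝ}

namespace IsDelayModel

theorem isProbabilityMeasure (hM : IsDelayModel P seed D μ) : IsProbabilityMeasure μ := by
  rw [← hM.map_eq 0]
  exact Measure.isProbabilityMeasure_map (hM.measurable 0).aemeasurable

omit [IsProbabilityMeasure P] in
theorem ae_delay (hM : IsDelayModel P seed D μ) {p : ℝ → Prop} (hp : ∀ᵐ x ∂μ, p x) :
    ∀ᵐ ω ∂P, ∀ k, p (D k ω) := by
  refine ae_all_iff.2 fun k => ?_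
  rw [← hM.map_eq k] at hp
  exact ae_of_ae_map (hM.measurable k).aemeasurable hp

omit [IsProbabilityMeasure P] in
theorem ae_nonneg (hM : IsDelayModel P seed D μ) (hμ : DelayAssumption μ Dlb Dub Mlb Mub) :
    ∀ᵐ ω ∂P, ∀ k, 0 ≤ D k ω :=
  hM.ae_delay (hμ.absolutelyContinuous.ae_le (ae_restrict_mem measurableSet_Ici))

omit [IsProbabilityMeasure P] in
theorem integral_comp (hM : IsDelayModel P seed D μ) {f : ℝ → ℝ} (hf : Measurable f) (k : ℕ) :
    ∫ ω, f (D k ω) ∂P = ∫ x, f x ∂μ := by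
  rw [← hM.map_eq k, integral_map (hM.measurable k).aemeasurable hf.aestronglyMeasurable]

omit [IsProbabilityMeasure P] in
theorem integrable_comp (hM : IsDelayModel P seed D μ) {f : ℝ → ℝ} (hf : Measurable f)
    (hint : Integrable f μ) (k : ℕ) : Integrable (fun ω => f (D k ω)) P := by
  rw [← hM.map_eq k] at hint
  exact (integrable_map_measure hf.aestronglyMeasurable (hM.measurable k).aemeasurable).1 hint

omit [IsProbabilityMeasure P] in
theorem integral_delay (hM : IsDelayModel P seed D μ) (k : ℕ) :
    ∫ ω, D k ω ∂P = ∫ x, x ∂μ :=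
  hM.integral_comp measurable_id k

omit [IsProbabilityMeasure P] in
theorem integrable_delay (hM : IsDelayModel P seed D μ)
    (hμ : DelayAssumption μ Dlb Dub Mlb Mub) (k : ℕ) : Integrable (D k) P :=
  hM.integrable_comp measurable_id hμ.integrable k

omit [IsProbabilityMeasure P] in
theorem memLp (hM : IsDelayModel P seed D μ) (hμ : DelayAssumption μ Dlb Dub Mlb Mub) (k : ℕ) :
    MemLp (D k) 2 P :=
  (memLp_two_iff_integrable_sq (hM.measurable k).aestronglyMeasurable).2
    (hM.integrable_comp (f := fun x => x ^ 2) (by fun_prop) hμ.integrable_sq k)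

theorem indepFun (hM : IsDelayModel P seed D μ) {k : ℕ} {X : Ω → ℝ}
    (hX : Measurable[history seed D k] X) : IndepFun X (D (k + 1)) P :=
  indepFun_of_measurable_history hM.measurable_seed hM.measurable hM.iIndepFun hM.indepFun_seed hX

end IsDelayModel

variable {W : ℕ → Ω → ℝ} {Wub : ℝ}

section Policy

variable (hM : IsDelayModel P seed D μ) (hμ : DelayAssumption μ Dlb Dub Mlb Mub)
  (hW : IsPolicy P seed D Wub W)
include hM hW

theorem memLp_wait (k : ℕ) : MemLp (W k) 2 P := by
  have hmeas : Measurable (W k) := (hW.causal k).mono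
    (history_le hM.measurable_seed hM.measurable k) le_rfl
  refine MemLp.of_bound hmeas.aestronglyMeasurable Wub ?_
  filter_upwards [hW.bounded k] with ω hω
  rw [Real.norm_eq_abs, abs_of_nonneg hω.1]
  exact hω.2

include hμ

theorem memLp_length (k : ℕ) : MemLp (fun ω => D k ω + W k ω) 2 P :=
  (hM.memLp hμ k).add (memLp_wait hM hW k)

theorem integrable_length (k : ℕ) : Integrable (fun ω => D k ω + W k ω) P :=
  (memLp_length hM hμ hW k).integrable (by norm_num)

theorem mean_le_integral_length (k : ℕ) : ∫ x, x ∂μ ≤ ∫ ω, D k ω + W k ω ∂P := by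
  rw [← hM.integral_delay k]
  refine integral_mono_ae (hM.integrable_delay hμ k)
    (integrable_length hM hμ hW k) ?_
  filter_upwards [hW.bounded k] with ω hω
  simpa using hω.1

theorem integral_length_le (k : ℕ) : ∫ ω, D k ω + W k ω ∂P ≤ (∫ x, x ∂μ) + Wub := by
  rw [← hM.integral_delay k]
  have hD := hM.integrable_delay hμ k
  have h := integral_mono_ae (integrable_length hM hμ hW k) (hD.add (integrable_const Wub)) ?_
  · rw [integral_add' hD (integrable_const Wub)] at h
    simpa using h
  · filter_upwards [hW.bounded k] with ω hω
    simpa using hω.2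

theorem integral_length_sq_le (k : ℕ) :
    ∫ ω, (D k ω + W k ω) ^ 2 / 2 ∂P ≤ (∫ x, x ^ 2 ∂μ) + Wub ^ 2 := by
  rw [← hM.integral_comp (f := fun x => x ^ 2) (by fun_prop) k]
  have hD := (hM.memLp hμ k).integrable_sq
  have h := integral_mono_ae ((memLp_length hM hμ hW k).integrable_sq.div_const 2)
    (hD.add (integrable_const (Wub ^ 2))) ?_
  · rw [integral_add' hD (integrable_const (Wub ^ 2))] at h
    simpa using h
  · filter_upwards [hW.bounded k] with ω hω
    simp only [Pi.add_apply]
    nlinarith [sq_nonneg (D k ω - W k ω), hω.1, hω.2]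

/-- For every threshold, the cost of a cycle is at least that of the threshold policy. -/
theorem integral_cycleCost_le (γ : ℝ) (k : ℕ) :
    ∫ x, cycleCost γ x ∂μ ≤
      ∫ ω, (D k ω + W k ω) ^ 2 / 2 ∂P - γ * ∫ ω, D k ω + W k ω ∂P := by
  have := hM.isProbabilityMeasure
  have hsq := (memLp_length hM hμ hW k).integrable_sq.div_const 2
  have hlin := (integrable_length hM hμ hW k).const_mul γ
  rw [← hM.integral_comp (continuous_cycleCost_right γ).measurable k, ← integral_const_mul,
    ← integral_sub hsq hlin]
  refine integral_mono_ae (hM.integrable_comp (continuous_cycleCost_right γ).measurable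
    (integrable_cycleCost hμ γ) k) (hsq.sub hlin) ?_
  filter_upwards [hW.bounded k] with ω hω
  exact cycleCost_le (le_add_of_nonneg_right hω.1)

theorem integral_samplingTime (K : ℕ) :
    ∫ ω, samplingTime (fun k => D k ω) (fun k => W k ω) K ∂P =
      ∑ k ∈ Finset.range K, ∫ ω, D k ω + W k ω ∂P := by
  simp only [samplingTime_eq_sum]
  exact integral_finsetSum _ fun k _ => integrable_length hM hμ hW k

/-- Causality enters here: the length of cycle k is measurable with respect to the history up to k,
hence independent of the next delay. -/
theorem integral_prevLength_mul (a₀ : ℝ) (k : ℕ) :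
    Integrable (fun ω => prevLength a₀ (fun j => D j ω + W j ω) k * D k ω) P ∧
      ∫ ω, prevLength a₀ (fun j => D j ω + W j ω) k * D k ω ∂P =
        prevLength a₀ (fun j => ∫ ω, D j ω + W j ω ∂P) k * ∫ x, x ∂μ := by
  have hD := hM.integrable_delay hμ
  have hmean := hM.integral_delay
  cases k with
  | zero =>
    simp only [prevLength]
    exact ⟨(hD 0).const_mul a₀, by rw [integral_const_mul, hmean]⟩
  | succ k =>
    have hind : IndepFun (fun ω => D k ω + W k ω) (D (k + 1)) P :=
      hM.indepFun ((measurable_delay_history le_rfl).add (hW.causal k))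
    have hL := integrable_length hM hμ hW k
    simp only [prevLength]
    refine ⟨hind.integrable_mul hL (hD _), ?_⟩
    rw [hind.integral_fun_mul_eq_mul_integral hL.aestronglyMeasurable
      (hD _).aestronglyMeasurable, hmean]

theorem integral_cumulativeAge (a₀ : ℝ) (K : ℕ) :
    ∫ ω, cumulativeAge a₀ (fun k => D k ω) (fun k => W k ω) K ∂P =
      ∑ k ∈ Finset.range K, ∫ ω, (D k ω + W k ω) ^ 2 / 2 ∂P +
        (∑ k ∈ Finset.range K, prevLength a₀ (fun j => ∫ ω, D j ω + W j ω ∂P) k) * ∫ x, x ∂μ := by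
  have hsq (k : ℕ) := (memLp_length hM hμ hW k).integrable_sq.div_const 2
  have hae : (fun ω => cumulativeAge a₀ (fun k => D k ω) (fun k => W k ω) K) =ᵐ[P]
      fun ω => ∑ k ∈ Finset.range K, ((D k ω + W k ω) ^ 2 / 2 +
        prevLength a₀ (fun j => D j ω + W j ω) k * D k ω) := by
    filter_upwards [hM.ae_nonneg hμ, ae_all_iff.2 hW.bounded] with ω hd hw
    exact cumulativeAge_eq_sum hd (fun k => (hw k).1) a₀ K
  have hint (k : ℕ) : Integrable (fun ω => (D k ω + W k ω) ^ 2 / 2 +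
      prevLength a₀ (fun j => D j ω + W j ω) k * D k ω) P :=
    (hsq k).add (integral_prevLength_mul hM hμ hW a₀ k).1
  rw [integral_congr_ae hae, integral_finsetSum _ fun k _ => hint k, Finset.sum_mul,
    ← Finset.sum_add_distrib]
  refine Finset.sum_congr rfl fun k _ => ?_
  rw [integral_add (hsq k) (integral_prevLength_mul hM hμ hW a₀ k).1,
    (integral_prevLength_mul hM hμ hW a₀ k).2]

omit hW in
theorem exists_tendsto_zero_averageAge_eq (hW : IsPolicy P seed D Wub W) (a₀ : ℝ) :
    ∃ ε : ℕ → ℝ, Tendsto ε atTop (𝓝 0) ∧ averageAge P a₀ D W = limsup (fun K : ℕ =>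
      (∑ k ∈ Finset.range K, ∫ ω, (D k ω + W k ω) ^ 2 / 2 ∂P) /
        (∑ k ∈ Finset.range K, ∫ ω, D k ω + W k ω ∂P) + ∫ x, x ∂μ + ε K) atTop := by
  have hlim := tendsto_sum_prevLength_sub_div (a₀ := a₀) hμ.mean_pos
    (mean_le_integral_length hM hμ hW) (integral_length_le hM hμ hW)
  refine ⟨_, by simpa using hlim.mul_const (∫ x, x ∂μ), ?_⟩
  refine limsup_congr ?_
  filter_upwards [eventually_ge_atTop 1] with K hK
  rw [integral_cumulativeAge hM hμ hW, integral_samplingTime hM hμ hW]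
  have hpos : 0 < ∑ k ∈ Finset.range K, ∫ ω, D k ω + W k ω ∂P :=
    Finset.sum_pos (fun k _ => hμ.mean_pos.trans_le (mean_le_integral_length hM hμ hW k))
      ⟨0, Finset.mem_range.2 hK⟩
  field_simp
  ring

theorem le_averageAge (a₀ : ℝ) {γ : ℝ} (hγ : 0 ≤ ∫ x, cycleCost γ x ∂μ) :
    γ + ∫ x, x ∂μ ≤ averageAge P a₀ D W := by
  obtain ⟨ε, hε, havg⟩ := exists_tendsto_zero_averageAge_eq hM hμ hW a₀
  have hpos (K : ℕ) (hK : 1 ≤ K) : 0 < ∑ k ∈ Finset.range K, ∫ ω, D k ω + W k ω ∂P :=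
    Finset.sum_pos (fun k _ => hμ.mean_pos.trans_le (mean_le_integral_length hM hμ hW k))
      ⟨0, Finset.mem_range.2 hK⟩
  have hlow : Tendsto (fun K => γ + ∫ x, x ∂μ + ε K) atTop (𝓝 (γ + ∫ x, x ∂μ)) := by
    simpa using hε.const_add (γ + ∫ x, x ∂μ)
  rw [havg, ← hlow.limsup_eq]
  refine limsup_le_limsup ?_ hlow.isCoboundedUnder_le ?_
  · filter_upwards [eventually_ge_atTop 1] with K hK
    gcongr
    rw [le_div_iff₀ (hpos K hK), Finset.mul_sum]
    refine Finset.sum_le_sum fun k _ => ?_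
    linarith [integral_cycleCost_le hM hμ hW γ k]
  -- Comparing real-valued `limsup`s needs an upper bound; the cap on waiting times supplies it,
  -- with the mean delay bounding the denominator below.
  · set C := ((∫ x, x ^ 2 ∂μ) + Wub ^ 2) / ∫ x, x ∂μ
    have hup : Tendsto (fun K => C + ∫ x, x ∂μ + ε K) atTop (𝓝 (C + ∫ x, x ∂μ)) := by
      simpa using hε.const_add (C + ∫ x, x ∂μ)
    refine hup.isBoundedUnder_le.mono_le ?_
    filter_upwards [eventually_ge_atTop 1] with K hK
    gcongr
    rw [div_le_iff₀ (hpos K hK), Finset.mul_sum]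
    refine Finset.sum_le_sum fun k _ => (integral_length_sq_le hM hμ hW k).trans ?_
    have hC : 0 ≤ C := by
      have := hμ.mean_pos
      have h2 := hμ.sq_lb_pos.trans_le hμ.sq_lb_le
      positivity
    calc (∫ x, x ^ 2 ∂μ) + Wub ^ 2 = C * ∫ x, x ∂μ := (div_mul_cancel₀ _ hμ.mean_pos.ne').symm
      _ ≤ _ := mul_le_mul_of_nonneg_left (mean_le_integral_length hM hμ hW k) hC

/-- Without a bound on the sampling frequency, every causal policy is feasible. -/
theorem isFeasible_top : IsFeasible P seed D Wub ⊤ W := by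
  refine ⟨hW, ?_⟩
  rw [FrequencyConstraint]
  simp only [ENNReal.inv_top, ENNReal.toReal_zero, integral_samplingTime hM hμ hW]
  have h0 (k : ℕ) : 0 ≤ ∫ ω, D k ω + W k ω ∂P :=
    hμ.mean_pos.le.trans (mean_le_integral_length hM hμ hW k)
  refine le_liminf_of_le ?_ (Eventually.of_forall fun K =>
    div_nonneg (Finset.sum_nonneg fun k _ => h0 k) (Nat.cast_nonneg K))
  refine IsBoundedUnder.isCoboundedUnder_ge
    (isBoundedUnder_of ⟨(∫ x, x ∂μ) + Wub, fun K => ?_⟩)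
  have hC := (h0 0).trans (integral_length_le hM hμ hW 0)
  refine div_le_of_le_mul₀ (Nat.cast_nonneg K) hC ?_
  have := Finset.sum_le_card_nsmul (Finset.range K) _ _
    (fun k _ => integral_length_le hM hμ hW k)
  rwa [Finset.card_range, nsmul_eq_mul, mul_comm] at this

end Policy

/-! ### Optimality of the threshold policy -/

section Threshold

variable (hM : IsDelayModel P seed D μ) (hμ : DelayAssumption μ Dlb Dub Mlb Mub)
include hM hμ

omit [IsProbabilityMeasure P] in
theorem isPolicy_thresholdPolicy {γ : ℝ} (h0 : 0 ≤ γ) (hγ : γ ≤ Wub) :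
    IsPolicy P seed D Wub (thresholdPolicy D γ) where
  causal k := (measurable_const.sub (measurable_delay_history le_rfl)).max measurable_const
  bounded k := by
    filter_upwards [hM.ae_nonneg hμ] with ω hω
    exact ⟨le_max_right _ _, max_le (by linarith [hω k]) (h0.trans hγ)⟩

omit hM hμ [MeasurableSpace Ω] [IsProbabilityMeasure P] in
theorem add_thresholdPolicy (D : ℕ → Ω → ℝ) (γ : ℝ) (k : ℕ) (ω : Ω) :
    D k ω + thresholdPolicy D γ k ω = max (D k ω) γ := by
  rw [thresholdPolicy, ← max_add_add_left, add_zero, add_sub_cancel, max_comm]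

theorem averageAge_thresholdPolicy (a₀ : ℝ) {γ : ℝ} (h0 : 0 ≤ γ)
    (hγ : ∫ x, cycleCost γ x ∂μ = 0) :
    averageAge P a₀ D (thresholdPolicy D γ) = γ + ∫ x, x ∂μ := by
  -- With nonnegative delays, γ itself caps the waiting times.
  have hW : IsPolicy P seed D γ (thresholdPolicy D γ) := isPolicy_thresholdPolicy hM hμ h0 le_rfl
  obtain ⟨ε, hε, havg⟩ := exists_tendsto_zero_averageAge_eq hM hμ hW a₀
  rw [havg]
  refine Tendsto.limsup_eq ?_
  have hlim : Tendsto (fun K => γ + ∫ x, x ∂μ + ε K) atTop (𝓝 (γ + ∫ x, x ∂μ)) := by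
    simpa using hε.const_add (γ + ∫ x, x ∂μ)
  refine hlim.congr' ?_
  filter_upwards [eventually_ge_atTop 1] with K hK
  have hpos : 0 < ∑ k ∈ Finset.range K, ∫ ω, D k ω + thresholdPolicy D γ k ω ∂P :=
    Finset.sum_pos (fun k _ => hμ.mean_pos.trans_le (mean_le_integral_length hM hμ hW k))
      ⟨0, Finset.mem_range.2 hK⟩
  congr 2
  rw [eq_div_iff hpos.ne', Finset.mul_sum]
  refine Finset.sum_congr rfl fun k _ => ?_
  have hsq := (memLp_length hM hμ hW k).integrable_sq.div_const 2
  have hlin := (integrable_length hM hμ hW k).const_mul γ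
  rw [← hM.integral_comp (continuous_cycleCost_right γ).measurable k] at hγ
  have : ∫ ω, cycleCost γ (D k ω) ∂P = ∫ ω, (D k ω + thresholdPolicy D γ k ω) ^ 2 / 2 ∂P -
      γ * ∫ ω, D k ω + thresholdPolicy D γ k ω ∂P := by
    rw [← integral_const_mul, ← integral_sub hsq hlin]
    simp only [add_thresholdPolicy, cycleCost]
  linarith

/-- The root of the threshold equation gives the minimum average age. -/
theorem isLeast_averageAge (a₀ : ℝ) {γ : ℝ} (h0 : 0 ≤ γ) (hγW : γ ≤ Wub)
    (hγ : ∫ x, cycleCost γ x ∂μ = 0) :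
    IsLeast {a : ℝ | ∃ W, IsFeasible P seed D Wub ⊤ W ∧ averageAge P a₀ D W = a}
      (γ + ∫ x, x ∂μ) := by
  refine ⟨⟨_, isFeasible_top hM hμ (isPolicy_thresholdPolicy hM hμ h0 hγW),
    averageAge_thresholdPolicy hM hμ a₀ h0 hγ⟩, ?_⟩
  rintro _ ⟨W, hW, rfl⟩
  exact le_averageAge hM hμ hW.1 a₀ hγ.ge

theorem minAverageAge_eq (a₀ : ℝ) {γ : ℝ} (h0 : 0 ≤ γ) (hγW : γ ≤ Wub)
    (hγ : ∫ x, cycleCost γ x ∂μ = 0) :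
    minAverageAge P a₀ seed D Wub ⊤ = γ + ∫ x, x ∂μ :=
  (isLeast_averageAge hM hμ a₀ h0 hγW hγ).csInf_eq

end Threshold

end Model

/-! ### Sequences -/

/-- With M the maximum, the contraction turns M/(k+1) into M/(k+3), and (k+2)(k+4) ≤ (k+3)² absorbs
the noise because c ≤ M. The recursion starts at k = 1, so 2b ≤ M covers the indices 0 and 1. -/
theorem le_div_of_stochastic_approximation_recursion {a : ℕ → ℝ} {b c : ℝ} (hb : ∀ k, a k ≤ b)
    (hrec : ∀ k : ℕ, 1 ≤ k → a (k + 1) ≤ (1 - 2 / ((k : ℝ) + 3)) * a k + c / ((k : ℝ) + 3) ^ 2)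
    (hb0 : 0 ≤ b) (k : ℕ) : a k ≤ max c (2 * b) / ((k : ℝ) + 1) := by
  set M := max c (2 * b)
  have hcM : c ≤ M := le_max_left _ _
  have hbM : 2 * b ≤ M := le_max_right _ _
  induction k with
  | zero => simpa using (hb 0).trans (by linarith)
  | succ k ih =>
    rcases Nat.eq_zero_or_pos k with rfl | hk
    · have := hb 1
      norm_num
      linarith
    · refine (hrec k hk).trans ?_
      have h3 : (0 : ℝ) < (k : ℝ) + 3 := by positivity
      have h2 : (0 : ℝ) < (k : ℝ) + 2 := by positivity
      have h1 : (0 : ℝ) < (k : ℝ) + 1 := by positivity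
      have hcoef : (1 : ℝ) - 2 / ((k : ℝ) + 3) = ((k : ℝ) + 1) / ((k : ℝ) + 3) := by
        field_simp; ring
      rw [hcoef]
      calc ((k : ℝ) + 1) / ((k : ℝ) + 3) * a k + c / ((k : ℝ) + 3) ^ 2
          ≤ ((k : ℝ) + 1) / ((k : ℝ) + 3) * (M / ((k : ℝ) + 1)) + M / ((k : ℝ) + 3) ^ 2 := by
            gcongr
        _ = M * (((k : ℝ) + 4) / ((k : ℝ) + 3) ^ 2) := by field_simp; ring
        _ ≤ M * (1 / ((k : ℝ) + 2)) := by
            refine mul_le_mul_of_nonneg_left ?_ (by linarith)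
            rw [div_le_div_iff₀ (by positivity) h2]
            nlinarith
        _ = M / (((k + 1 : ℕ) : ℝ) + 1) := by push_cast; ring

/-- From n² to the next square there are at most 2n intermediate steps, each of size at most
c/(n²+1), so the drift is O(1/n). -/
theorem tendsto_of_tendsto_sq {x : ℕ → ℝ} {l c : ℝ}
    (hinc : ∀ k : ℕ, |x (k + 1) - x k| ≤ c / ((k : ℝ) + 1))
    (hsq : Tendsto (fun n : ℕ => x (n ^ 2)) atTop (𝓝 l)) : Tendsto x atTop (𝓝 l) := by
  have hc : 0 ≤ c := by simpa using (abs_nonneg _).trans (hinc 0)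
  have hstep (m j : ℕ) : |x (m + j) - x m| ≤ j * (c / ((m : ℝ) + 1)) := by
    induction j with
    | zero => simp
    | succ j ih =>
      have h₁ := hinc (m + j)
      have h₂ : c / (((m + j : ℕ) : ℝ) + 1) ≤ c / ((m : ℝ) + 1) := by
        gcongr; simp
      have h₃ := abs_sub_le (x (m + j + 1)) (x (m + j)) (x m)
      rw [← add_assoc]
      push_cast at *
      linarith
  have hsqrt : Tendsto Nat.sqrt atTop atTop :=
    tendsto_atTop_mono' atTop (Eventually.of_forall fun n => le_rfl)
      (tendsto_atTop_atTop.2 fun b => ⟨b * b, fun n hn => Nat.le_sqrt.2 hn⟩)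
  have hgap : Tendsto (fun k : ℕ => x k - x (Nat.sqrt k ^ 2)) atTop (𝓝 0) := by
    have hlim : Tendsto (fun n : ℕ => 2 * c * (1 / ((n : ℝ) + 1)) * 2) atTop (𝓝 0) := by
      simpa using (tendsto_one_div_add_atTop_nhds_zero_nat.const_mul (2 * c)).mul_const 2
    refine squeeze_zero_norm (fun k => ?_) (hlim.comp hsqrt)
    set n := Nat.sqrt k with hn
    have h₁ : n ^ 2 ≤ k := by rw [sq]; exact Nat.sqrt_le k
    have h₂ : k - n ^ 2 ≤ 2 * n := by
      have := Nat.sqrt_le_add k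
      rw [← hn] at this
      rw [sq]; omega
    have h₃ := hstep (n ^ 2) (k - n ^ 2)
    rw [Nat.add_sub_cancel' h₁] at h₃
    refine h₃.trans ?_
    have h₄ : ((k - n ^ 2 : ℕ) : ℝ) ≤ 2 * n := by exact_mod_cast h₂
    calc ((k - n ^ 2 : ℕ) : ℝ) * (c / (((n ^ 2 : ℕ) : ℝ) + 1))
        ≤ (2 * n) * (c / (((n ^ 2 : ℕ) : ℝ) + 1)) := by gcongr
      _ ≤ 2 * c * (1 / ((n : ℝ) + 1)) * 2 := by
        push_cast
        have : (n : ℝ) / ((n : ℝ) ^ 2 + 1) ≤ 2 / ((n : ℝ) + 1) := by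
          rw [div_le_div_iff₀ (by positivity) (by positivity)]
          nlinarith [sq_nonneg ((n : ℝ) - 1)]
        calc 2 * (n : ℝ) * (c / ((n : ℝ) ^ 2 + 1)) = 2 * c * ((n : ℝ) / ((n : ℝ) ^ 2 + 1)) := by
              ring
          _ ≤ 2 * c * (2 / ((n : ℝ) + 1)) := by gcongr
          _ = _ := by ring
  simpa using hgap.add (hsq.comp hsqrt)

/-- By Tonelli the series ∑ X_n has finite expectation, so it converges almost surely and its terms
vanish. -/
theorem ae_tendsto_zero_of_summable_integral {Ω : Type*} [MeasurableSpace Ω] {P : Measure Ω}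
    {X : ℕ → Ω → ℝ} {b : ℕ → ℝ} (hX : ∀ n, Integrable (X n) P) (h0 : ∀ n ω, 0 ≤ X n ω)
    (hXb : ∀ n, ∫ ω, X n ω ∂P ≤ b n) (hb : Summable b) :
    ∀ᵐ ω ∂P, Tendsto (fun n => X n ω) atTop (𝓝 0) := by
  have hmeas (n : ℕ) : AEMeasurable (fun ω => ENNReal.ofReal (X n ω)) P :=
    (hX n).aestronglyMeasurable.aemeasurable.ennreal_ofReal
  have hfin : ∫⁻ ω, ∑' n, ENNReal.ofReal (X n ω) ∂P ≠ ∞ := by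
    rw [lintegral_tsum hmeas]
    refine ne_top_of_le_ne_top hb.tsum_ofReal_ne_top (ENNReal.tsum_le_tsum fun n => ?_)
    rw [← ofReal_integral_eq_lintegral_ofReal (hX n) (Eventually.of_forall (h0 n))]
    exact ENNReal.ofReal_le_ofReal (hXb n)
  filter_upwards [ae_lt_top' (AEMeasurable.tsum hmeas) hfin] with ω hω
  have := ENNReal.tendsto_atTop_zero_of_tsum_ne_top hω.ne
  have h := (ENNReal.tendsto_toReal ENNReal.zero_ne_top).comp this
  simpa [Function.comp_def, ENNReal.toReal_ofReal (h0 _ ω)] using h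

/-! ### The online sampler -/

theorem clip_mem {lb ub : ℝ} (h : lb ≤ ub) (z : ℝ) : min ub (max z lb) ∈ Set.Icc lb ub :=
  ⟨le_min h (le_max_right _ _), min_le_left _ _⟩

theorem abs_clip_sub_le {lb ub g : ℝ} (hg : g ∈ Set.Icc lb ub) (z : ℝ) :
    |min ub (max z lb) - g| ≤ |z - g| := by
  have hg' : min ub (max g lb) = g := by rw [max_eq_left hg.1, min_eq_right hg.2]
  calc |min ub (max z lb) - g| = |min ub (max z lb) - min ub (max g lb)| := by rw [hg']
    _ ≤ |max z lb - max g lb| := by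
      simpa [min_comm] using abs_min_sub_min_le_max ub (max z lb) ub (max g lb)
    _ ≤ |z - g| := abs_max_sub_max_le_abs z g lb

section Path

variable {Dlb Dub Mub V γ₁ : ℝ} {d : ℕ → ℝ}

theorem add_onlineWait_zero (V γ x : ℝ) : x + onlineWait V γ 0 x = max x γ := by
  rw [onlineWait, zero_div, add_zero, ← max_add_add_left, add_zero, add_sub_cancel, max_comm]

theorem stepSize_nonneg (hDlb : 0 < Dlb) (n : ℕ) : 0 ≤ stepSize Dlb n := by
  rw [stepSize]; split_ifs <;> positivity

theorem stepSize_succ_le (hDlb : 0 < Dlb) (k : ℕ) :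
    stepSize Dlb (k + 1) ≤ 1 / Dlb / ((k : ℝ) + 1) := by
  rw [stepSize, div_div]
  split_ifs with h
  · obtain rfl : k = 0 := by omega
    apply one_div_le_one_div_of_le <;> norm_num <;> linarith
  · apply one_div_le_one_div_of_le (by positivity)
    push_cast
    nlinarith

theorem stepSize_succ_of_pos {k : ℕ} (hk : 1 ≤ k) :
    stepSize Dlb (k + 1) = 1 / (((k : ℝ) + 3) * Dlb) := by
  rw [stepSize, if_neg (by omega)]
  push_cast
  ring_nf

variable (hDlb : 0 < Dlb) (hlu : gammaLb Dlb ≤ gammaUb Dlb Dub Mub ⊤)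
  (hγ₁ : γ₁ ∈ Set.Icc (gammaLb Dlb) (gammaUb Dlb Dub Mub ⊤))
include hlu hγ₁

theorem onlineThreshold_mem (k : ℕ) : onlineThreshold Dlb Dub Mub ⊤ V γ₁ d k ∈
    Set.Icc (gammaLb Dlb) (gammaUb Dlb Dub Mub ⊤) := by
  cases k with
  | zero => exact hγ₁
  | succ k => exact clip_mem hlu _

include hDlb

/-- Without a bound on the sampling frequency, the constraint is never violated. -/
theorem onlineState_snd (k : ℕ) : (onlineState Dlb Dub Mub ⊤ V γ₁ d k).2 = 0 := by
  induction k with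
  | zero => rfl
  | succ k ih =>
    have hmem := onlineThreshold_mem (V := V) (d := d) hlu hγ₁ k
    simp only [onlineState, onlineStep, ih, add_onlineWait_zero, ENNReal.inv_top,
      ENNReal.toReal_zero]
    refine max_eq_right ?_
    have h₁ := le_max_right (d k) (onlineThreshold Dlb Dub Mub ⊤ V γ₁ d k)
    have h₂ : 0 < gammaLb Dlb := half_pos hDlb
    rw [onlineThreshold] at h₁ hmem
    linarith [hmem.1]

theorem add_onlineWaiting (k : ℕ) : d k + onlineWaiting Dlb Dub Mub ⊤ V γ₁ d k =
    max (d k) (onlineThreshold Dlb Dub Mub ⊤ V γ₁ d k) := by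
  rw [onlineWaiting, onlineState_snd hDlb hlu hγ₁, add_onlineWait_zero, onlineThreshold]

/-- With no accumulated violation, the increment Q - γL is exactly the minimal cycle cost: an
unbiased sample of the function whose root is sought. -/
theorem onlineThreshold_succ (k : ℕ) : onlineThreshold Dlb Dub Mub ⊤ V γ₁ d (k + 1) =
    min (gammaUb Dlb Dub Mub ⊤) (max (onlineThreshold Dlb Dub Mub ⊤ V γ₁ d k +
      stepSize Dlb (k + 1) * cycleCost (onlineThreshold Dlb Dub Mub ⊤ V γ₁ d k) (d k))
      (gammaLb Dlb)) := by
  simp only [onlineThreshold, onlineState, onlineStep, onlineState_snd hDlb hlu hγ₁,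
    add_onlineWait_zero, cycleCost]

variable {C : ℝ} (hC : gammaUb Dlb Dub Mub ⊤ ≤ C) (hdC : ∀ k, d k ≤ C)
include hC hdC

theorem abs_cycleCost_onlineThreshold_le (k : ℕ) :
    |cycleCost (onlineThreshold Dlb Dub Mub ⊤ V γ₁ d k) (d k)| ≤ C ^ 2 := by
  have hmem := onlineThreshold_mem (V := V) (d := d) hlu hγ₁ k
  exact abs_cycleCost_le ((half_pos hDlb).le.trans hmem.1) (hmem.2.trans hC) (hdC k)

theorem abs_onlineThreshold_succ_sub_le (k : ℕ) :
    |onlineThreshold Dlb Dub Mub ⊤ V γ₁ d (k + 1) - onlineThreshold Dlb Dub Mub ⊤ V γ₁ d k| ≤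
      C ^ 2 / Dlb / ((k : ℝ) + 1) := by
  rw [onlineThreshold_succ hDlb hlu hγ₁]
  refine (abs_clip_sub_le (onlineThreshold_mem hlu hγ₁ k) _).trans ?_
  rw [add_sub_cancel_left, abs_mul, abs_of_nonneg (stepSize_nonneg hDlb _)]
  calc _ ≤ 1 / Dlb / ((k : ℝ) + 1) * C ^ 2 :=
        mul_le_mul (stepSize_succ_le hDlb k)
          (abs_cycleCost_onlineThreshold_le hDlb hlu hγ₁ hC hdC k) (abs_nonneg _) (by positivity)
    _ = _ := by ring

/-- Projection does not increase the distance to g. Splitting off `cycleCost g` in the cross term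
leaves a part that will have mean zero, plus a negative drift. -/
theorem sq_onlineThreshold_succ_sub_le {g : ℝ}
    (hg : g ∈ Set.Icc (gammaLb Dlb) (gammaUb Dlb Dub Mub ⊤)) (k : ℕ) :
    (onlineThreshold Dlb Dub Mub ⊤ V γ₁ d (k + 1) - g) ^ 2 ≤
      (onlineThreshold Dlb Dub Mub ⊤ V γ₁ d k - g) ^ 2 + 2 * stepSize Dlb (k + 1) *
        ((onlineThreshold Dlb Dub Mub ⊤ V γ₁ d k - g) * cycleCost g (d k) -
          (onlineThreshold Dlb Dub Mub ⊤ V γ₁ d k - g) ^ 2 * d k) +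
        stepSize Dlb (k + 1) ^ 2 * C ^ 4 := by
  have hcost := abs_cycleCost_onlineThreshold_le (V := V) hDlb hlu hγ₁ hC hdC k
  rw [onlineThreshold_succ hDlb hlu hγ₁]
  set x := onlineThreshold Dlb Dub Mub ⊤ V γ₁ d k
  set η := stepSize Dlb (k + 1)
  have hη : 0 ≤ η := stepSize_nonneg hDlb _
  refine (sq_le_sq.2 (abs_clip_sub_le hg _)).trans ?_
  have h₁ := mul_le_mul_of_nonneg_left (sub_mul_cycleCost_sub_le x g (d k)) hη
  have h₂ : cycleCost x (d k) ^ 2 ≤ C ^ 4 := by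
    have := sq_le_sq' (abs_le.1 hcost).1 (abs_le.1 hcost).2
    linarith
  have h₃ := mul_le_mul_of_nonneg_left h₂ (sq_nonneg η)
  nlinarith

end Path

/-! ### Convergence of the threshold estimates -/

section Online

variable {Ω : Type*} [MeasurableSpace Ω] {P : Measure Ω} [IsProbabilityMeasure P]
  {γ₁ : Ω → ℝ} {D : ℕ → Ω → ℝ} {μ : Measure ℝ} {Dlb Dub Mlb Mub B V : ℝ}

omit [MeasurableSpace Ω] in
-- The state entering cycle k + 1 has seen only the seed and the delays 0, …, k, so it is
-- independent of delay k + 1.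
theorem measurable_onlineState_succ (k : ℕ) : Measurable[history γ₁ D k] fun ω =>
    onlineState Dlb Dub Mub ⊤ V (γ₁ ω) (fun i => D i ω) (k + 1) := by
  have hstep (η : ℝ) : Measurable fun p : ℝ × ℝ × ℝ =>
      onlineStep Dlb Dub Mub ⊤ V η p.1 p.2 := by
    unfold onlineStep onlineWait
    fun_prop
  have hsucc (k : ℕ) (h : Measurable[history γ₁ D k] fun ω =>
      onlineState Dlb Dub Mub ⊤ V (γ₁ ω) (fun i => D i ω) k) : Measurable[history γ₁ D k] fun ω =>
      onlineState Dlb Dub Mub ⊤ V (γ₁ ω) (fun i => D i ω) (k + 1) :=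
    (hstep (stepSize Dlb (k + 1))).comp ((measurable_delay_history le_rfl).prodMk h)
  induction k with
  | zero => exact hsucc 0 ((measurable_seed_history 0).prodMk measurable_const)
  | succ k ih => exact hsucc (k + 1) (ih.mono (history_mono _ _ k.le_succ) le_rfl)

variable (hM : IsDelayModel P γ₁ D μ)
include hM

omit [IsProbabilityMeasure P] in
theorem measurable_onlineThreshold (k : ℕ) : Measurable fun ω =>
    onlineThreshold Dlb Dub Mub ⊤ V (γ₁ ω) (fun i => D i ω) k := by
  cases k with
  | zero => exact hM.measurable_seed
  | succ k =>
    exact (measurable_fst.comp (measurable_onlineState_succ k)).mono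
      (history_le hM.measurable_seed hM.measurable k) le_rfl

theorem indepFun_onlineThreshold (k : ℕ) : IndepFun (fun ω =>
    onlineThreshold Dlb Dub Mub ⊤ V (γ₁ ω) (fun i => D i ω) k) (D k) P := by
  cases k with
  | zero => exact hM.indepFun_seed.comp measurable_id (measurable_pi_apply 0)
  | succ k => exact hM.indepFun (measurable_fst.comp (measurable_onlineState_succ k))

variable (hμ : DelayAssumption μ Dlb Dub Mlb Mub) (hB : ∀ᵐ x ∂μ, x < B)
  (hγ₁ : ∀ᵐ ω ∂P, γ₁ ω ∈ Set.Icc (gammaLb Dlb) (gammaUb Dlb Dub Mub ⊤))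
include hμ hγ₁

theorem integrable_onlineThreshold_sub_pow (g : ℝ) (n k : ℕ) : Integrable (fun ω =>
    (onlineThreshold Dlb Dub Mub ⊤ V (γ₁ ω) (fun i => D i ω) k - g) ^ n) P := by
  have := hM.isProbabilityMeasure
  refine Integrable.of_bound (((measurable_onlineThreshold hM k).sub_const g).pow_const
    n).aestronglyMeasurable ((gammaUb Dlb Dub Mub ⊤ + |g|) ^ n) ?_
  filter_upwards [hγ₁] with ω hω
  have hmem := onlineThreshold_mem (V := V) (d := fun i => D i ω) (gammaLb_le_gammaUb hμ) hω k
  rw [norm_pow, Real.norm_eq_abs]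
  refine pow_le_pow_left₀ (abs_nonneg _) ((abs_sub _ _).trans ?_) n
  rw [abs_of_nonneg ((gammaLb_pos hμ).le.trans hmem.1)]
  linarith [hmem.2]

include hB

/-- Independence of the estimate and the current delay makes the `cycleCost g` term vanish in mean,
and bounds the drift by `Dlb` times the mean square error. -/
theorem integral_sq_onlineThreshold_succ_sub_le {g : ℝ}
    (hg : g ∈ Set.Icc (gammaLb Dlb) (gammaUb Dlb Dub Mub ⊤)) (hroot : ∫ x, cycleCost g x ∂μ = 0)
    (k : ℕ) :
    ∫ ω, (onlineThreshold Dlb Dub Mub ⊤ V (γ₁ ω) (fun i => D i ω) (k + 1) - g) ^ 2 ∂P ≤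
      (1 - 2 * stepSize Dlb (k + 1) * Dlb) *
        ∫ ω, (onlineThreshold Dlb Dub Mub ⊤ V (γ₁ ω) (fun i => D i ω) k - g) ^ 2 ∂P +
      stepSize Dlb (k + 1) ^ 2 * max (gammaUb Dlb Dub Mub ⊤) B ^ 4 := by
  have := hM.isProbabilityMeasure
  set η := stepSize Dlb (k + 1)
  set C := max (gammaUb Dlb Dub Mub ⊤) B
  set X : Ω → ℝ := fun ω => onlineThreshold Dlb Dub Mub ⊤ V (γ₁ ω) (fun i => D i ω) k
  have hη : 0 ≤ η := stepSize_nonneg hμ.lb_pos _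
  have hX : Integrable (fun ω => X ω - g) P := by
    simpa using integrable_onlineThreshold_sub_pow hM hμ hγ₁ g 1 k
  have hX2 : Integrable (fun ω => (X ω - g) ^ 2) P :=
    integrable_onlineThreshold_sub_pow hM hμ hγ₁ g 2 k
  have hind : IndepFun X (D k) P := indepFun_onlineThreshold hM k
  have hi₁ : IndepFun (fun ω => X ω - g) (fun ω => cycleCost g (D k ω)) P :=
    hind.comp (measurable_id.sub_const g) (continuous_cycleCost_right g).measurable
  have hi₂ : IndepFun (fun ω => (X ω - g) ^ 2) (D k) P :=
    hind.comp ((measurable_id.sub_const g).pow_const 2) measurable_id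
  have hcost : Integrable (fun ω => cycleCost g (D k ω)) P :=
    hM.integrable_comp (continuous_cycleCost_right g).measurable (integrable_cycleCost hμ g) k
  have hp₁ : Integrable (fun ω => (X ω - g) * cycleCost g (D k ω)) P := hi₁.integrable_mul hX hcost
  have hp₂ : Integrable (fun ω => (X ω - g) ^ 2 * D k ω) P :=
    hi₂.integrable_mul hX2 (hM.integrable_delay hμ k)
  have hsub : Integrable (fun ω => 2 * η * ((X ω - g) * cycleCost g (D k ω) -
      (X ω - g) ^ 2 * D k ω)) P := (hp₁.sub hp₂).const_mul _
  have hadd : Integrable (fun ω => (X ω - g) ^ 2 + 2 * η * ((X ω - g) * cycleCost g (D k ω) -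
      (X ω - g) ^ 2 * D k ω)) P := hX2.add hsub
  have hle := integral_mono_ae (integrable_onlineThreshold_sub_pow (V := V) hM hμ hγ₁ g 2 (k + 1))
    (hadd.add (integrable_const (η ^ 2 * C ^ 4))) (by
      filter_upwards [hγ₁, hM.ae_delay hB] with ω hω hD
      exact sq_onlineThreshold_succ_sub_le hμ.lb_pos (gammaLb_le_gammaUb hμ) hω
        (le_max_left _ B) (fun i => (hD i).le.trans (le_max_right _ B)) hg k)
  rw [integral_add' hadd (integrable_const _), integral_add hX2 hsub, integral_const_mul,
    integral_sub hp₁ hp₂,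
    hi₁.integral_fun_mul_eq_mul_integral hX.aestronglyMeasurable hcost.aestronglyMeasurable,
    hi₂.integral_fun_mul_eq_mul_integral hX2.aestronglyMeasurable
      (hM.measurable k).aestronglyMeasurable,
    hM.integral_comp (continuous_cycleCost_right g).measurable, hroot, hM.integral_delay,
    integral_const, probReal_univ, one_smul] at hle
  refine hle.trans ?_
  have h0 : 0 ≤ ∫ ω, (X ω - g) ^ 2 ∂P := integral_nonneg fun ω => sq_nonneg _
  nlinarith [mul_le_mul_of_nonneg_left hμ.lb_le_mean (mul_nonneg hη h0)]

/-- The mean square error of the threshold estimates decays like `1 / k`. -/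
theorem exists_integral_sq_onlineThreshold_sub_le {g : ℝ}
    (hg : g ∈ Set.Icc (gammaLb Dlb) (gammaUb Dlb Dub Mub ⊤))
    (hroot : ∫ x, cycleCost g x ∂μ = 0) : ∃ M, 0 ≤ M ∧ ∀ k : ℕ,
    ∫ ω, (onlineThreshold Dlb Dub Mub ⊤ V (γ₁ ω) (fun i => D i ω) k - g) ^ 2 ∂P ≤
      M / ((k : ℝ) + 1) := by
  have := hM.isProbabilityMeasure
  have hDlb := hμ.lb_pos
  refine ⟨_, ?_, le_div_of_stochastic_approximation_recursion (b := gammaUb Dlb Dub Mub ⊤ ^ 2)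
    (c := max (gammaUb Dlb Dub Mub ⊤) B ^ 4 / Dlb ^ 2) (fun k => ?_) (fun k hk => ?_) (sq_nonneg _)⟩
  · exact le_max_of_le_left (by positivity)
  · have h := integral_mono_ae (integrable_onlineThreshold_sub_pow (V := V) hM hμ hγ₁ g 2 k)
      (integrable_const (gammaUb Dlb Dub Mub ⊤ ^ 2)) (by
        filter_upwards [hγ₁] with ω hω
        have hmem := onlineThreshold_mem (V := V) (d := fun i => D i ω)
          (gammaLb_le_gammaUb hμ) hω k
        have hlb := gammaLb_pos hμ
        exact sq_le_sq' (by linarith [hmem.1, hg.2]) (by linarith [hmem.2, hg.1]))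
    simpa using h
  · refine (integral_sq_onlineThreshold_succ_sub_le hM hμ hB hγ₁ hg hroot k).trans (le_of_eq ?_)
    -- For `k ≥ 1` the step gives 2η`Dlb` = 2/(k+3), the contraction rate that yields O(1/k).
    rw [stepSize_succ_of_pos hk]
    congr 1
    · congr 2
      field_simp
    · field_simp

/-- The threshold estimates converge to the root of the threshold equation. -/
theorem ae_tendsto_onlineThreshold {g : ℝ}
    (hg : g ∈ Set.Icc (gammaLb Dlb) (gammaUb Dlb Dub Mub ⊤))
    (hroot : ∫ x, cycleCost g x ∂μ = 0) : ∀ᵐ ω ∂P, Tendsto (fun k =>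
      onlineThreshold Dlb Dub Mub ⊤ V (γ₁ ω) (fun i => D i ω) k) atTop (𝓝 g) := by
  have := hM.isProbabilityMeasure
  obtain ⟨M, hM0, hle⟩ := exists_integral_sq_onlineThreshold_sub_le (V := V) hM hμ hB hγ₁ hg hroot
  have hsum : Summable fun n : ℕ => M * (1 / (n : ℝ) ^ 2) :=
    (Real.summable_one_div_nat_pow.2 one_lt_two).mul_left M
  have hsum' : Summable fun n : ℕ => M / (((n ^ 2 : ℕ) : ℝ) + 1) := by
    refine (summable_nat_add_iff 1).1 (Summable.of_nonneg_of_le (fun n => by positivity)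
      (fun n => ?_) ((summable_nat_add_iff 1).2 hsum))
    rw [mul_one_div]
    push_cast
    gcongr
    linarith
  have hae := ae_tendsto_zero_of_summable_integral
    (fun n : ℕ => integrable_onlineThreshold_sub_pow (V := V) hM hμ hγ₁ g 2 (n ^ 2))
    (fun n ω => sq_nonneg _) (fun n => hle (n ^ 2)) hsum'
  filter_upwards [hae, hγ₁, hM.ae_delay hB] with ω hω hmem hD
  refine tendsto_of_tendsto_sq (abs_onlineThreshold_succ_sub_le hμ.lb_pos (gammaLb_le_gammaUb hμ)
    hmem (le_max_left _ B) (fun i => (hD i).le.trans (le_max_right _ B))) ?_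
  have h := hω.sqrt
  simp only [Real.sqrt_sq_eq_abs, Real.sqrt_zero] at h
  exact tendsto_sub_nhds_zero_iff.1 ((tendsto_zero_iff_abs_tendsto_zero _).2 h)

end Online

/-! ### Running averages -/

theorem tendsto_average_of_sub_tendsto_zero {u v : ℕ → ℝ} {l : ℝ}
    (h : Tendsto (fun k => u k - v k) atTop (𝓝 0))
    (hv : Tendsto (fun n : ℕ => (∑ k ∈ Finset.range n, v k) / n) atTop (𝓝 l)) :
    Tendsto (fun n : ℕ => (∑ k ∈ Finset.range n, u k) / n) atTop (𝓝 l) := by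
  have := h.cesaro.add hv
  rw [zero_add] at this
  refine this.congr fun n => ?_
  rw [Finset.sum_sub_distrib]
  ring

theorem tendsto_average_of_succ {f : ℕ → ℝ} {l : ℝ}
    (h : Tendsto (fun n : ℕ => (∑ k ∈ Finset.range n, f (k + 1)) / n) atTop (𝓝 l)) :
    Tendsto (fun n : ℕ => (∑ k ∈ Finset.range n, f k) / n) atTop (𝓝 l) := by
  rw [← tendsto_add_atTop_iff_nat 1]
  have h₁ : Tendsto (fun n : ℕ => f 0 * (1 / ((n : ℝ) + 1))) atTop (𝓝 0) := by
    simpa using tendsto_one_div_add_atTop_nhds_zero_nat.const_mul (f 0)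
  have h₂ : Tendsto (fun n : ℕ => (n : ℝ) / ((n : ℝ) + 1)) atTop (𝓝 1) :=
    tendsto_natCast_div_add_atTop 1
  have := (h.mul h₂).add h₁
  rw [mul_one, add_zero] at this
  refine this.congr fun n => ?_
  rw [Finset.sum_range_succ']
  rcases Nat.eq_zero_or_pos n with rfl | hn
  · simp
  · push_cast
    field_simp

theorem sum_range_eq_sum_even_add_sum_odd (f : ℕ → ℝ) (n : ℕ) :
    ∑ k ∈ Finset.range n, f k = ∑ j ∈ Finset.range ((n + 1) / 2), f (2 * j) +
      ∑ j ∈ Finset.range (n / 2), f (2 * j + 1) := by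
  induction n with
  | zero => simp
  | succ n ih =>
    rw [Finset.sum_range_succ, ih]
    rcases Nat.even_or_odd' n with ⟨m, rfl | rfl⟩
    · rw [show (2 * m + 1 + 1) / 2 = m + 1 by omega, show (2 * m + 1) / 2 = m by omega,
        show 2 * m / 2 = m by omega, Finset.sum_range_succ _ m]
      ring
    · rw [show (2 * m + 1 + 1 + 1) / 2 = m + 1 by omega, show (2 * m + 1 + 1) / 2 = m + 1 by omega,
        show (2 * m + 1) / 2 = m by omega, Finset.sum_range_succ (fun j => f (2 * j + 1)) m]
      ring

theorem tendsto_average_of_even_of_odd {f : ℕ → ℝ} {l : ℝ}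
    (h₀ : Tendsto (fun n : ℕ => (∑ j ∈ Finset.range n, f (2 * j)) / n) atTop (𝓝 l))
    (h₁ : Tendsto (fun n : ℕ => (∑ j ∈ Finset.range n, f (2 * j + 1)) / n) atTop (𝓝 l)) :
    Tendsto (fun n : ℕ => (∑ k ∈ Finset.range n, f k) / n) atTop (𝓝 l) := by
  have hhalf (a : ℕ) (ha : a ≤ 1) :
      Tendsto (fun n : ℕ => (((n + a) / 2 : ℕ) : ℝ) / n) atTop (𝓝 (1 / 2)) := by
    rw [← tendsto_sub_nhds_zero_iff]
    refine squeeze_zero_norm' ?_ tendsto_one_div_atTop_nhds_zero_nat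
    filter_upwards [eventually_ge_atTop 1] with n hn
    have hn' : (0 : ℝ) < n := by exact_mod_cast hn
    have e₁ : (((n + a) / 2 : ℕ) : ℝ) * 2 ≤ n + 1 := by
      exact_mod_cast (show (n + a) / 2 * 2 ≤ n + 1 by omega)
    have e₂ : (n : ℝ) ≤ (((n + a) / 2 : ℕ) : ℝ) * 2 + 1 := by
      exact_mod_cast (show n ≤ (n + a) / 2 * 2 + 1 by omega)
    rw [Real.norm_eq_abs, show (((n + a) / 2 : ℕ) : ℝ) / n - 1 / 2 =
      ((((n + a) / 2 : ℕ) : ℝ) * 2 - n) / 2 / n by field_simp, abs_div, abs_of_pos hn']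
    gcongr
    rw [abs_le]
    constructor <;> linarith
  have hatTop (a : ℕ) : Tendsto (fun n : ℕ => (n + a) / 2) atTop atTop :=
    tendsto_atTop_atTop.2 fun b => ⟨2 * b, fun n hn => by omega⟩
  have := ((h₀.comp (hatTop 1)).mul (hhalf 1 le_rfl)).add
    ((h₁.comp (hatTop 0)).mul (hhalf 0 zero_le_one))
  rw [show l * (1 / 2) + l * (1 / 2) = l by ring] at this
  refine this.congr fun n => ?_
  -- The odd class is empty for n = 1; there `S 0 = 0` makes division by zero harmless.
  have hcancel (S : ℕ → ℝ) (hS : S 0 = 0) (m : ℕ) : S m / m * ((m : ℝ) / n) = S m / n := by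
    rcases Nat.eq_zero_or_pos m with rfl | hm
    · simp [hS]
    · field_simp
  simp only [Function.comp_apply, add_zero]
  rw [hcancel (fun m => ∑ j ∈ Finset.range m, f (2 * j)) (by simp),
    hcancel (fun m => ∑ j ∈ Finset.range m, f (2 * j + 1)) (by simp),
    sum_range_eq_sum_even_add_sum_odd f n, add_div]

/-- The time-average age along a path whose thresholds converge. -/
theorem tendsto_averageAge_of_tendsto_threshold {d x : ℕ → ℝ} {a₀ g m δ C : ℝ} (hm : 0 < m)
    (hd : ∀ k, d k ∈ Set.Icc 0 C) (hx : Tendsto x atTop (𝓝 g)) (hg : 0 ≤ g)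
    (h₁ : Tendsto (fun n : ℕ => (∑ k ∈ Finset.range n, max (d k) g) / n) atTop (𝓝 m))
    (h₂ : Tendsto (fun n : ℕ => (∑ k ∈ Finset.range n, max (d k) g ^ 2 / 2) / (n : ℝ)) atTop
      (𝓝 (g * m)))
    (h₃ : Tendsto (fun n : ℕ => (∑ k ∈ Finset.range n, max (d k) g * d (k + 1)) / n) atTop
      (𝓝 (m * δ))) :
    Tendsto (fun n : ℕ => (∑ k ∈ Finset.range n, (max (d k) (x k) ^ 2 / 2 +
      prevLength a₀ (fun k => max (d k) (x k)) k * d k)) /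
        ∑ k ∈ Finset.range n, max (d k) (x k)) atTop (𝓝 (g + δ)) := by
  have hx0 : Tendsto (fun k => |x k - g|) atTop (𝓝 0) := by
    simpa using (hx.sub_const g).abs
  have hmax (k : ℕ) : |max (d k) (x k) - max (d k) g| ≤ |x k - g| := by
    simpa [max_comm] using abs_max_sub_max_le_abs (x k) g (d k)
  have hlen : Tendsto (fun k => max (d k) (x k) - max (d k) g) atTop (𝓝 0) :=
    squeeze_zero_norm hmax hx0
  have hlen_sq : Tendsto (fun k => max (d k) (x k) ^ 2 / 2 - max (d k) g ^ 2 / 2) atTop (𝓝 0) := by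
    have hbd : Tendsto (fun k => |x k - g| * ((|x k - g| + 2 * (C + g)) / 2)) atTop (𝓝 0) := by
      simpa using hx0.mul ((hx0.add_const (2 * (C + g))).div_const 2)
    refine squeeze_zero_norm (fun k => ?_) hbd
    rw [show max (d k) (x k) ^ 2 / 2 - max (d k) g ^ 2 / 2 = (max (d k) (x k) - max (d k) g) *
      (((max (d k) (x k) - max (d k) g) + 2 * max (d k) g) / 2) by ring, norm_mul]
    refine mul_le_mul (hmax k) ?_ (norm_nonneg _) (abs_nonneg _)
    rw [Real.norm_eq_abs, abs_div, abs_two]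
    gcongr
    refine (abs_add_le _ _).trans (add_le_add (hmax k) ?_)
    have h0 : 0 ≤ max (d k) g := le_max_of_le_right hg
    rw [abs_of_nonneg (by positivity)]
    have : max (d k) g ≤ C + g :=
      max_le (by linarith [(hd k).2]) (by linarith [(hd k).1, (hd k).2])
    linarith
  have hprev : Tendsto (fun k => max (d k) (x k) * d (k + 1) - max (d k) g * d (k + 1)) atTop
      (𝓝 0) := by
    have hbd : Tendsto (fun k => |x k - g| * C) atTop (𝓝 0) := by simpa using hx0.mul_const C
    refine squeeze_zero_norm (fun k => ?_) hbd
    rw [← sub_mul, norm_mul]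
    refine mul_le_mul (hmax k) ?_ (norm_nonneg _) (abs_nonneg _)
    rw [Real.norm_eq_abs, abs_of_nonneg (hd _).1]
    exact (hd _).2
  -- Shifting by one discards the initial-age term and turns the previous-length products into those
  -- controlled by `h₃`.
  have hage := (tendsto_average_of_sub_tendsto_zero hlen_sq h₂).add (tendsto_average_of_succ
    (f := fun k => prevLength a₀ (fun k => max (d k) (x k)) k * d k)
    (tendsto_average_of_sub_tendsto_zero hprev h₃))
  have hdiv := hage.div (tendsto_average_of_sub_tendsto_zero hlen h₁) hm.ne'
  rw [show (g * m + m * δ) / m = g + δ by field_simp] at hdiv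
  refine hdiv.congr' ?_
  filter_upwards [eventually_ge_atTop 1] with n hn
  have hn' : (n : ℝ) ≠ 0 := by positivity
  rw [Pi.div_apply, ← add_div, div_div_div_cancel_right₀ hn', Finset.sum_add_distrib]

/-! ### Strong laws for single and consecutive delays -/

section StrongLaw

variable {Ω : Type*} [MeasurableSpace Ω] {P : Measure Ω} [IsProbabilityMeasure P]
  {seed : Ω → ℝ} {D : ℕ → Ω → ℝ} {μ : Measure ℝ} (hM : IsDelayModel P seed D μ)
include hM

omit [IsProbabilityMeasure P] in
theorem IsDelayModel.identDistrib (i j : ℕ) : IdentDistrib (D i) (D j) P P :=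
  ⟨(hM.measurable i).aemeasurable, (hM.measurable j).aemeasurable, by
    rw [hM.map_eq, hM.map_eq]⟩

omit [IsProbabilityMeasure P] in
theorem IsDelayModel.ae_tendsto_average {f : ℝ → ℝ} (hf : Measurable f) (hint : Integrable f μ) :
    ∀ᵐ ω ∂P, Tendsto (fun n : ℕ => (∑ k ∈ Finset.range n, f (D k ω)) / n) atTop
      (𝓝 (∫ x, f x ∂μ)) := by
  rw [← hM.integral_comp hf 0]
  exact strong_law_ae_real (fun k ω => f (D k ω)) (hM.integrable_comp hf hint 0)
    (fun i j hij => (hM.iIndepFun.indepFun hij).comp hf hf)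
    (fun i => (hM.identDistrib i 0).comp hf)

/-- Neighbouring products share a delay, but products of one parity use disjoint pairs, so each
parity class obeys the i.i.d. strong law. -/
theorem IsDelayModel.ae_tendsto_average_mul_succ {f : ℝ → ℝ} (hf : Measurable f)
    (hint : Integrable f μ) (hmean : Integrable (fun x : ℝ => x) μ) :
    ∀ᵐ ω ∂P, Tendsto (fun n : ℕ => (∑ k ∈ Finset.range n, f (D k ω) * D (k + 1) ω) / n) atTop
      (𝓝 ((∫ x, f x ∂μ) * ∫ x, x ∂μ)) := by
  have hφ : Measurable fun p : ℝ × ℝ => f p.1 * p.2 :=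
    (hf.comp measurable_fst).mul measurable_snd
  have hind (i : ℕ) : IndepFun (D i) (D (i + 1)) P := hM.iIndepFun.indepFun i.succ_ne_self.symm
  have hind' (i : ℕ) : IndepFun (fun ω => f (D i ω)) (D (i + 1)) P :=
    (hind i).comp hf measurable_id
  have hD (i : ℕ) : Integrable (D i) P := hM.integrable_comp measurable_id hmean i
  have hfD (i : ℕ) : Integrable (fun ω => f (D i ω)) P := hM.integrable_comp hf hint i
  have key (s : ℕ) : ∀ᵐ ω ∂P, Tendsto (fun n : ℕ =>
      (∑ j ∈ Finset.range n, f (D (2 * j + s) ω) * D (2 * j + s + 1) ω) / n) atTop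
      (𝓝 ((∫ x, f x ∂μ) * ∫ x, x ∂μ)) := by
    have h := strong_law_ae_real (μ := P)
      (fun j ω => f (D (2 * j + s) ω) * D (2 * j + s + 1) ω)
      ((hind' _).integrable_mul (hfD _) (hD _))
      (fun i j hij => (hM.iIndepFun.indepFun_prodMk_prodMk hM.measurable (2 * i + s)
        (2 * i + s + 1) (2 * j + s) (2 * j + s + 1) (by omega) (by omega) (by omega)
        (by omega)).comp hφ hφ)
      (fun i => ((hM.identDistrib _ _).prodMk (hM.identDistrib _ _) (hind _) (hind _)).comp hφ)
    rwa [(hind' _).integral_fun_mul_eq_mul_integral (hfD _).aestronglyMeasurable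
      (hD _).aestronglyMeasurable, hM.integral_comp hf, hM.integral_delay] at h
  filter_upwards [key 0, key 1] with ω h₀ h₁
  exact tendsto_average_of_even_of_odd (f := fun k => f (D k ω) * D (k + 1) ω) h₀ h₁

end StrongLaw

/-! ### Realized age of the online sampler -/

section Online

variable {Ω : Type*} [MeasurableSpace Ω] {P : Measure Ω} [IsProbabilityMeasure P]
  {γ₁ : Ω → ℝ} {D : ℕ → Ω → ℝ} {μ : Measure ℝ} {Dlb Dub Mlb Mub B V : ℝ}

/-- The realized time-average age of the online sampler converges. -/
theorem ae_tendsto_cumulativeAge_div (hM : IsDelayModel P γ₁ D μ)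
    (hμ : DelayAssumption μ Dlb Dub Mlb Mub) (hB : ∀ᵐ x ∂μ, x < B)
    (hγ₁ : ∀ᵐ ω ∂P, γ₁ ω ∈ Set.Icc (gammaLb Dlb) (gammaUb Dlb Dub Mub ⊤)) (a₀ : ℝ) {g : ℝ}
    (hg : g ∈ Set.Icc (gammaLb Dlb) (gammaUb Dlb Dub Mub ⊤)) (hroot : ∫ x, cycleCost g x ∂μ = 0) :
    ∀ᵐ ω ∂P, Tendsto (fun K : ℕ =>
      cumulativeAge a₀ (fun i => D i ω)
          (onlineWaiting Dlb Dub Mub ⊤ V (γ₁ ω) (fun i => D i ω)) K /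
        samplingTime (fun i => D i ω)
          (onlineWaiting Dlb Dub Mub ⊤ V (γ₁ ω) (fun i => D i ω)) K) atTop
      (𝓝 (g + ∫ x, x ∂μ)) := by
  have := hM.isProbabilityMeasure
  have hg0 : 0 < g := (gammaLb_pos hμ).trans_le hg.1
  have hmemLp : MemLp (fun x : ℝ => max x g) 2 μ :=
    MemLp.sup ((memLp_two_iff_integrable_sq (by fun_prop)).2 hμ.integrable_sq) (memLp_const g)
  have hint : Integrable (fun x : ℝ => max x g) μ := hmemLp.integrable (by norm_num)
  have hint_sq : Integrable (fun x : ℝ => max x g ^ 2 / 2) μ := hmemLp.integrable_sq.div_const 2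
  have hm : 0 < ∫ x, max x g ∂μ :=
    hμ.mean_pos.trans_le (integral_mono hμ.integrable hint fun x => le_max_left x g)
  have hsq : ∫ x, max x g ^ 2 / 2 ∂μ = g * ∫ x, max x g ∂μ := by
    simp only [cycleCost] at hroot
    rwa [integral_sub hint_sq (hint.const_mul g), integral_const_mul, sub_eq_zero] at hroot
  have hlim₁ := hM.ae_tendsto_average (by fun_prop) hint
  have hlim₂ := hM.ae_tendsto_average (by fun_prop) hint_sq
  have hlim₃ := hM.ae_tendsto_average_mul_succ (by fun_prop) hint hμ.integrable
  rw [hsq] at hlim₂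
  filter_upwards [hlim₁, hlim₂, hlim₃, ae_tendsto_onlineThreshold (V := V) hM hμ hB hγ₁ hg hroot,
    hγ₁, hM.ae_delay hB, hM.ae_nonneg hμ] with ω h₁ h₂ h₃ hx hmem hDB hD0
  have h := tendsto_averageAge_of_tendsto_threshold (a₀ := a₀) hm
    (fun k => ⟨hD0 k, (hDB k).le⟩) hx hg0.le h₁ h₂ h₃
  refine h.congr fun K => ?_
  have hW (k : ℕ) : 0 ≤ onlineWaiting Dlb Dub Mub ⊤ V (γ₁ ω) (fun i => D i ω) k :=
    le_max_right _ _
  rw [cumulativeAge_eq_sum hD0 hW, samplingTime_eq_sum]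
  have hlen (k : ℕ) : D k ω + onlineWaiting Dlb Dub Mub ⊤ V (γ₁ ω) (fun i => D i ω) k =
      max (D k ω) (onlineThreshold Dlb Dub Mub ⊤ V (γ₁ ω) (fun i => D i ω) k) :=
    add_onlineWaiting (d := fun i => D i ω) hμ.lb_pos (gammaLb_le_gammaUb hμ) hmem k
  simp only [hlen]

end Online

end AoI

theorem theorem2 {Ω : Type*} [MeasurableSpace Ω] (P : Measure Ω) [IsProbabilityMeasure P]
    (μ : Measure ℝ) (Dlb Dub Mlb Mub B Wub V a₀ : ℝ)
    (D : ℕ → Ω → ℝ) (γ₁ : Ω → ℝ)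
    -- the delays are i.i.d. with law `μ`
    (hD_meas : ∀ k, Measurable (D k))
    (hD_law : ∀ k, P.map (D k) = μ)
    (hD_indep : iIndepFun D P)
    (hμ : AoI.DelayAssumption μ Dlb Dub Mlb Mub)
    -- the delay is bounded
    (hB : ∀ᵐ x ∂μ, x < B)
    -- the initial estimate is uniform and independent of the delays
    (hγ₁_meas : Measurable γ₁)
    (hγ₁_law : pdf.IsUniform γ₁
      (Set.Icc (AoI.gammaLb Dlb) (AoI.gammaUb Dlb Dub Mub ⊤)) P volume)
    (hγ₁_indep : IndepFun γ₁ (fun ω k => D k ω) P)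
    -- parameters: Lagrange constant, initial age, cap on waiting times
    (hV : 0 < V) (ha₀ : 0 ≤ a₀)
    (hWub : AoI.gammaUb Dlb Dub Mub ⊤ ≤ Wub) :
    -- the minimum average age is attained by the threshold policy with threshold `γ⋆`
    (AoI.IsFeasible P γ₁ D Wub ⊤
        (AoI.thresholdPolicy D (AoI.optimalThreshold P a₀ γ₁ D μ Wub ⊤)) ∧
      AoI.averageAge P a₀ D
        (AoI.thresholdPolicy D (AoI.optimalThreshold P a₀ γ₁ D μ Wub ⊤)) =
          AoI.minAverageAge P a₀ γ₁ D Wub ⊤) ∧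
    -- almost sure convergence of the threshold estimates
    (∀ᵐ ω ∂P, Tendsto
      (fun k => AoI.onlineThreshold Dlb Dub Mub ⊤ V (γ₁ ω) (fun i => D i ω) k) atTop
      (𝓝 (AoI.optimalThreshold P a₀ γ₁ D μ Wub ⊤))) ∧
    -- almost sure convergence of the realized time-average age
    (∀ᵐ ω ∂P, Tendsto
      (fun K : ℕ =>
        AoI.cumulativeAge a₀ (fun i => D i ω)
            (AoI.onlineWaiting Dlb Dub Mub ⊤ V (γ₁ ω) (fun i => D i ω)) K /
          AoI.samplingTime (fun i => D i ω)
            (AoI.onlineWaiting Dlb Dub Mub ⊤ V (γ₁ ω) (fun i => D i ω)) K) atTop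
      (𝓝 (AoI.minAverageAge P a₀ γ₁ D Wub ⊤))) := by
  have hM : AoI.IsDelayModel P γ₁ D μ :=
    ⟨hγ₁_meas, hD_meas, hD_law, hD_indep, hγ₁_indep⟩
  have := hM.isProbabilityMeasure
  have hγ₁ : ∀ᵐ ω ∂P, γ₁ ω ∈ Set.Icc (AoI.gammaLb Dlb) (AoI.gammaUb Dlb Dub Mub ⊤) := by
    refine ae_of_ae_map hγ₁_meas.aemeasurable ?_
    rw [hγ₁_law]
    exact ae_cond_mem measurableSet_Icc
  obtain ⟨g, hg, hroot⟩ := AoI.exists_integral_cycleCost_eq_zero hμ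
  have hg0 : 0 ≤ g := (AoI.gammaLb_pos hμ).le.trans hg.1
  have hgW : g ≤ Wub := hg.2.trans hWub
  have hmin := AoI.minAverageAge_eq hM hμ a₀ hg0 hgW hroot
  -- Any root is identified with γ⋆ through the minimum value, so uniqueness need not be proved
  -- separately.
  have hopt : AoI.optimalThreshold P a₀ γ₁ D μ Wub ⊤ = g := by
    rw [AoI.optimalThreshold, hmin, add_sub_cancel_right]
  rw [hopt, hmin]
  exact ⟨⟨AoI.isFeasible_top hM hμ (AoI.isPolicy_thresholdPolicy hM hμ hg0 hgW),
    AoI.averageAge_thresholdPolicy hM hμ a₀ hg0 hroot⟩,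
    AoI.ae_tendsto_onlineThreshold hM hμ hB hγ₁ hg hroot,
    AoI.ae_tendsto_cumulativeAge_div hM hμ hB hγ₁ a₀ hg hroot⟩
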